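/- Let $\Delta(s)=2^s\pi^{s-1}\Gamma(1-s)\sin(\pi s/2)$ be the factor in the functional equation $\zeta(s)=\Delta(s)\zeta(1-s)$ of the Riemann zeta-function, and fix a complex number $a\neq 0$. The $a$-points of $\Delta$ are the solutions $\delta_a=\beta_a+i\gamma_a$ of $\Delta(s)=a$. (1) Let $t_0\ge 0$ and $1/2<B\le\infty$, and suppose that $t_0>0$, or $B<\infty$, or $a$ is real. Then for every $T$ the number $N_a(T)$ of $a$-points with $-1<\beta_a<B$ and $t_0<\gamma_a<T$ is finite, and, as $T\to\infty$, $$N_a(T)=\frac{T}{2\pi}\log\frac{T}{2\pi e}+O(\log T),$$ where the implicit constant depends only on $a$, $t_0$ and $B$. This holds whether or not the $a$-points are counted with multiplicity. (2) $\beta_a\to 1/2$ as $\gamma_a\to\infty$, where $\delta_a$ runs through all $a$-points. (3) The critical line is the only vertical Julia line for $\Delta$: a real number $\sigma$ has the property that for every $\varepsilon>0$ and every $T>0$ all complex numbers $b$, with at most one exception, are values $b=\Delta(z)$ at some $z$ with $|\operatorname{Re} z-\sigma|<\varepsilon$ and $\operatorname{Im} z>T$, if and only if $\sigma=1/2$.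 -/

import Mathlib

open Complex Filter Topology Asymptotics

noncomputable section

/-- The factor `Δ(s) = 2^s π^(s-1) Γ(1-s) sin(πs/2)` of the functional equation
`ζ(s) = Δ(s) ζ(1-s)`. Everything below only uses its values in the open upper half-plane, where
the formula has no singularities. -/
def feDelta (s : ℂ) : ℂ :=
  2 ^ s * (Real.pi : ℂ) ^ (s - 1) * Complex.Gamma (1 - s) * Complex.sin (Real.pi * s / 2)

/-- The `a`-points `β + iγ` of `Δ` with `-1 < β < B` and `t₀ < γ < T`
(`B = ⊤` means that there is no upper bound for `β`). -/
def aPoints (a : ℂ) (t₀ : ℝ) (B : EReal) (T : ℝ) : Set ℂ :=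
  {s : ℂ | feDelta s = a ∧ -1 < s.re ∧ (s.re : EReal) < B ∧ t₀ < s.im ∧ s.im < T}

/-- The number of `a`-points in `aPoints a t₀ B T`, counted with multiplicity. -/
def aPointCount (a : ℂ) (t₀ : ℝ) (B : EReal) (T : ℝ) : ℕ :=
  ∑ᶠ s ∈ aPoints a t₀ B T, analyticOrderNatAt (fun z : ℂ => feDelta z - a) s

/-- The vertical line `σ + iℝ` is a Julia line for `f` (at infinity, in the upward direction):
for every `ε > 0` and `T > 0`, every complex number with at most one exception is a value `f z`
with `|Re z - σ| < ε` and `Im z > T`. -/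
def IsVerticalJuliaLine (f : ℂ → ℂ) (σ : ℝ) : Prop :=
  ∀ ε : ℝ, 0 < ε → ∀ T : ℝ, 0 < T →
    {a : ℂ | ¬ ∃ z : ℂ, f z = a ∧ |z.re - σ| < ε ∧ T < z.im}.Subsingleton

end

/-- The functional equation, which identifies `feDelta`. -/
theorem riemannZeta_eq_feDelta_mul {s : ℂ} (hs : 0 < s.im) :
    riemannZeta s = feDelta s * riemannZeta (1 - s) := by
  have h1 : ∀ n : ℕ, 1 - s ≠ -n := by
    intro n h
    have := congrArg Complex.im h
    simp at this
    exact hs.ne' this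
  have h2 : 1 - s ≠ 1 := by
    intro h
    have := congrArg Complex.im h
    simp at this
    exact hs.ne' this
  have h := riemannZeta_one_sub h1 h2
  rw [sub_sub_cancel] at h
  have hpi : (Real.pi : ℂ) ≠ 0 := by exact_mod_cast Real.pi_ne_zero
  have hcos : Complex.cos (Real.pi * (1 - s) / 2) = Complex.sin (Real.pi * s / 2) := by
    rw [← Complex.cos_pi_div_two_sub]
    congr 1
    ring
  have hpow : (2 : ℂ) * (2 * Real.pi) ^ (-(1 - s)) = 2 ^ s * (Real.pi : ℂ) ^ (s - 1) := by
    have h3 := Complex.mul_cpow_ofReal_nonneg (a := 2) (b := Real.pi) (by norm_num)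
      Real.pi_pos.le (-(1 - s))
    push_cast at h3
    rw [h3, neg_sub, ← mul_assoc, Complex.cpow_sub _ _ two_ne_zero, Complex.cpow_one]
    field_simp
  rw [h, hcos, hpow, feDelta]

/-! Let L be a branch of log Δ on the open first quadrant and s = σ + it. Then L' = log 2π − ψ(s) +
(π/2) tan(πs/2). Stirling's formula for ψ and tan → i give Re L' ≤ −log(t/2π) + O(1/t) uniformly in
σ > 0, and L' = −log(t/2π) + O(1/t) for 0 < σ ≤ 1. This has three consequences. Since |Δ| = 1 on the
critical line, integration along horizontals and the symmetry s ↦ 1 − s̄ give |σ − 1/2| (log(t/2π) −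
1) ≤ |log |Δ(s)|| (`abs_re_sub_half_mul_le`), so the `a`-points approach the line. Since Re L' < 0
high up, L is injective there (`injOn_logFeDelta`), so an `a`-point is determined by the integer m
in L(s) = log a − 2πim. Since L' is nearly a large constant close to the line, L maps small discs
over large ones, so each m admitted by the argument on the line is attained
(`exists_height_exists_feDelta_eq`).

Counting `a`-points is thus counting integers: up to O(log T), the answer is the decrease of arg
Δ(1/2 + it) divided by 2π, and integrating −log(t/2π) + O(1/t) gives the main term. High `a`-points
are simple and the low ones contribute a constant, provided they are finite in number. In bounded
regions this is the identity theorem. Far to the right, the recursion under s ↦ s + 2 drives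
`a`-points of bounded height towards the real poles of Δ, which is impossible if t₀ > 0; for real a,
comparison with the conjugate point excludes them too.

Every nonzero value is taken arbitrarily high near the critical line, whereas 1 and −1 are both
missed high up near any other vertical line; this settles the Julia lines. -/

/-! ### Stirling's formula for the digamma function. -/

/-- The difference between the digamma function and the logarithm. -/
noncomputable def digammaSubLog (z : ℂ) : ℂ := digamma z - log z

/-- The second order remainder `log (1 + z⁻¹) - z⁻¹`. -/
noncomputable def logRemainder (z : ℂ) : ℂ := log (1 + z⁻¹) - z⁻¹

theorem norm_logRemainder_le {z : ℂ} (hz : 2 ≤ ‖z‖) : ‖logRemainder z‖ ≤ (‖z‖ ^ 2)⁻¹ := by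
  have h0 : ‖z⁻¹‖ ≤ 2⁻¹ := by
    rw [norm_inv]; exact inv_anti₀ (by norm_num) hz
  have h1 : ‖z⁻¹‖ < 1 := h0.trans_lt (by norm_num)
  refine (norm_log_one_add_sub_self_le h1).trans ?_
  have h2 : (1 - ‖z⁻¹‖)⁻¹ ≤ 2 := by
    rw [inv_le_comm₀ (by linarith) (by norm_num)]; linarith
  calc ‖z⁻¹‖ ^ 2 * (1 - ‖z⁻¹‖)⁻¹ / 2 ≤ ‖z⁻¹‖ ^ 2 * 2 / 2 := by gcongr
    _ = (‖z‖ ^ 2)⁻¹ := by rw [norm_inv, inv_pow]; ring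

theorem ne_neg_natCast_of_re_pos {z : ℂ} (hz : 0 < z.re) (m : ℕ) : z ≠ -m := by
  rintro rfl
  have h : (0 : ℝ) ≤ m := m.cast_nonneg
  simp only [neg_re, natCast_re] at hz
  linarith

theorem log_add_one_of_re_pos {z : ℂ} (hz : 0 < z.re) :
    log (z + 1) = log z + log (1 + z⁻¹) := by
  have hz0 : z ≠ 0 := by rintro rfl; simp at hz
  have h1 : 0 < (1 + z⁻¹).re := by
    have : 0 < z.re / normSq z := div_pos hz (normSq_pos.2 hz0)
    simp only [add_re, one_re, inv_re]; linarith
  have h10 : 1 + z⁻¹ ≠ 0 := fun h => by rw [h] at h1; simp at h1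
  have e : z + 1 = z * (1 + z⁻¹) := by field_simp
  rw [e, log_mul hz0 h10]
  have a1 := abs_lt.1 (abs_arg_lt_pi_div_two_iff.2 (Or.inl hz))
  have a2 := abs_lt.1 (abs_arg_lt_pi_div_two_iff.2 (Or.inl h1))
  constructor <;> linarith [a1.1, a1.2, a2.1, a2.2]

theorem digammaSubLog_eq_add {z : ℂ} (hz : 0 < z.re) :
    digammaSubLog z = logRemainder z + digammaSubLog (z + 1) := by
  rw [digammaSubLog, digammaSubLog, logRemainder,
    digamma_apply_add_one z (ne_neg_natCast_of_re_pos hz), log_add_one_of_re_pos hz]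
  ring

theorem digammaSubLog_eq_sum_add {z : ℂ} (hz : 0 < z.re) (N : ℕ) :
    digammaSubLog z = ∑ j ∈ Finset.range N, logRemainder (z + j) + digammaSubLog (z + N) := by
  induction N with
  | zero => simp
  | succ n ih =>
    have : 0 < (z + n).re := by simp; positivity
    rw [ih, digammaSubLog_eq_add this, Finset.sum_range_succ]
    push_cast
    ring_nf

theorem digamma_ofReal {x : ℝ} (hx : 0 < x) :
    DifferentiableAt ℝ (Real.log ∘ Real.Gamma) x ∧
      digamma x = ((deriv (Real.log ∘ Real.Gamma) x : ℝ) : ℂ) := by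
  have hc := (differentiableAt_Gamma (x : ℂ)
    (ne_neg_natCast_of_re_pos (by simpa using hx))).hasDerivAt
  have hg := hc.real_of_complex
  have e : (fun y : ℝ => (Gamma (y : ℂ)).re) = Real.Gamma := by
    ext y; rw [Gamma_ofReal, ofReal_re]
  rw [e] at hg
  have hlog := hg.log (Real.Gamma_pos_of_pos hx).ne'
  refine ⟨hlog.differentiableAt, ?_⟩
  have hd : deriv (Real.log ∘ Real.Gamma) x = (deriv Gamma (x : ℂ)).re / Real.Gamma x :=
    hlog.deriv
  have h2 : deriv Gamma (x : ℂ) = (((deriv Gamma (x : ℂ)).re : ℝ) : ℂ) := by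
    have h3 := hg.ofReal_comp
    have h4 := hc.comp_ofReal
    have e2 : (fun y : ℝ => ((Real.Gamma y : ℝ) : ℂ)) = fun y : ℝ => Gamma (y : ℂ) := by
      ext y; rw [Gamma_ofReal]
    rw [e2] at h3
    exact h4.unique h3
  rw [hd, digamma_def, logDeriv_apply, Gamma_ofReal]
  push_cast
  rw [← h2]

/-- Log-convexity of Γ (Bohr–Mollerup) puts the derivative of log Γ at x between the slopes over [x
− 1, x] and [x, x + 1], which are log (x − 1) and log x. -/
theorem norm_digammaSubLog_ofReal_le {x : ℝ} (hx : 1 < x) :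
    ‖digammaSubLog x‖ ≤ (x - 1)⁻¹ := by
  have hx0 : 0 < x := by linarith
  obtain ⟨hd, he⟩ := digamma_ofReal hx0
  have feq : ∀ y : ℝ, 0 < y →
      (Real.log ∘ Real.Gamma) (y + 1) = (Real.log ∘ Real.Gamma) y + Real.log y := by
    intro y hy
    simp only [Function.comp]
    rw [Real.Gamma_add_one hy.ne', Real.log_mul hy.ne' (Real.Gamma_pos_of_pos hy).ne', add_comm]
  have hub : deriv (Real.log ∘ Real.Gamma) x ≤ Real.log x := by
    have := Real.convexOn_log_Gamma.deriv_le_slope (x := x) (y := x + 1) hx0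
      (by simp; linarith) (by linarith) hd
    rwa [slope_def_field, feq x hx0, add_sub_cancel_left, add_sub_cancel_left, div_one] at this
  have hlb : Real.log (x - 1) ≤ deriv (Real.log ∘ Real.Gamma) x := by
    have := Real.convexOn_log_Gamma.slope_le_deriv (x := x - 1) (y := x)
      (by simp; linarith) hx0 (by linarith) hd
    have h5 := feq (x - 1) (by linarith)
    rw [sub_add_cancel] at h5
    rwa [slope_def_field, h5, add_sub_cancel_left, sub_sub_cancel, div_one] at this
  have hlog : Real.log x - Real.log (x - 1) ≤ (x - 1)⁻¹ := by
    rw [← Real.log_div hx0.ne' (by linarith)]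
    refine (Real.log_le_sub_one_of_pos (div_pos hx0 (by linarith))).trans (le_of_eq ?_)
    have : x - 1 ≠ 0 := by linarith
    field_simp
    ring
  rw [digammaSubLog, he, ← ofReal_log hx0.le, ← ofReal_sub, norm_real, Real.norm_eq_abs, abs_le]
  constructor <;> linarith

theorem summable_inv_add_one_sq : Summable fun j : ℕ => (((j : ℝ) + 1) ^ 2)⁻¹ := by
  have := (summable_nat_add_iff 1).2 (Real.summable_nat_pow_inv (p := 2) |>.2 (by norm_num))
  simpa using this

theorem norm_logRemainder_add_natCast_le {z : ℂ} (hz : 2 < z.re) (j : ℕ) :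
    ‖logRemainder (z + j)‖ ≤ (((j : ℝ) + 1) ^ 2)⁻¹ := by
  have h1 : 2 + (j : ℝ) ≤ ‖z + j‖ := by
    refine le_trans ?_ (re_le_norm _)
    simp; linarith
  have h0 : (0 : ℝ) ≤ j := j.cast_nonneg
  refine (norm_logRemainder_le (by linarith)).trans ?_
  gcongr
  linarith

theorem differentiableAt_logRemainder {z : ℂ} (hz : 0 < z.re) :
    DifferentiableAt ℂ logRemainder z := by
  have hz0 : z ≠ 0 := by rintro rfl; simp at hz
  have h1 : 0 < (1 + z⁻¹).re := by
    have : 0 < z.re / normSq z := div_pos hz (normSq_pos.2 hz0)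
    simp only [add_re, one_re, inv_re]; linarith
  unfold logRemainder
  exact (((differentiableAt_const _).add (differentiableAt_inv hz0)).clog (Or.inl h1)).sub
    (differentiableAt_inv hz0)

theorem differentiableAt_digamma {z : ℂ} (hz : 0 < z.re) : DifferentiableAt ℂ digamma z := by
  have hopen : IsOpen {w : ℂ | 0 < w.re} := isOpen_lt continuous_const continuous_re
  have hG : DifferentiableOn ℂ Gamma {w : ℂ | 0 < w.re} := fun w hw =>
    (differentiableAt_Gamma w (ne_neg_natCast_of_re_pos hw)).differentiableWithinAt
  have := (hG.deriv hopen).div hG (fun w hw => Gamma_ne_zero_of_re_pos hw)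
  exact (this z hz).differentiableAt (hopen.mem_nhds hz)

/-- On the real axis the recursion telescopes, because the remainder at x + N tends to 0. Both sides
are holomorphic for Re z > 2, so the identity theorem, applied at 3, extends the equality. -/
theorem digammaSubLog_eq_tsum {z : ℂ} (hz : 2 < z.re) :
    digammaSubLog z = ∑' j : ℕ, logRemainder (z + j) := by
  have hopen : IsOpen {w : ℂ | 2 < w.re} := isOpen_lt continuous_const continuous_re
  have hconv : Convex ℝ {w : ℂ | 2 < w.re} := convex_halfSpace_re_gt 2
  have hS : DifferentiableOn ℂ (fun w => ∑' j : ℕ, logRemainder (w + j)) {w : ℂ | 2 < w.re} := by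
    refine differentiableOn_tsum_of_summable_norm summable_inv_add_one_sq (fun j w hw => ?_) hopen
      (fun j w hw => norm_logRemainder_add_natCast_le hw j)
    have hw' : 0 < (w + j).re := by
      have : 2 < w.re := hw
      simp; positivity
    exact ((differentiableAt_logRemainder hw').comp w
      (differentiableAt_id.add_const _)).differentiableWithinAt
  have hD : DifferentiableOn ℂ digammaSubLog {w : ℂ | 2 < w.re} := by
    intro w hw
    have hw0 : 0 < w.re := lt_trans (by norm_num) (show 2 < w.re from hw)
    exact ((differentiableAt_digamma hw0).sub
      (differentiableAt_log (Or.inl hw0))).differentiableWithinAt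
  have hreal : ∀ x : ℝ, 2 < x → digammaSubLog x = ∑' j : ℕ, logRemainder (x + j) := by
    intro x hx
    have hs : Summable fun j : ℕ => logRemainder (x + j) :=
      Summable.of_norm_bounded summable_inv_add_one_sq
        (fun j => norm_logRemainder_add_natCast_le (by simpa using hx) j)
    refine tendsto_nhds_unique ?_ hs.hasSum.tendsto_sum_nat
    have h0 : Tendsto (fun N : ℕ => digammaSubLog ((x : ℂ) + N)) atTop (𝓝 0) := by
      have hlim : Tendsto (fun N : ℕ => (x + (N : ℝ) - 1)⁻¹) atTop (𝓝 0) := by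
        refine tendsto_inv_atTop_zero.comp ?_
        simpa [sub_eq_add_neg, add_assoc, add_comm, add_left_comm] using
          tendsto_atTop_add_const_right atTop (x - 1) tendsto_natCast_atTop_atTop
      refine squeeze_zero_norm (fun N => ?_) hlim
      have := norm_digammaSubLog_ofReal_le (x := x + N)
        (by have : (0 : ℝ) ≤ N := N.cast_nonneg
            linarith)
      push_cast at this
      exact this
    have h1 : (fun N : ℕ => ∑ j ∈ Finset.range N, logRemainder ((x : ℂ) + j)) =
        fun N : ℕ => digammaSubLog x - digammaSubLog ((x : ℂ) + N) := by
      ext N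
      rw [digammaSubLog_eq_sum_add (z := x) (by simp; linarith) N]
      ring
    rw [h1]
    simpa using tendsto_const_nhds.sub h0
  have hfreq : ∃ᶠ w in 𝓝[≠] (3 : ℂ),
      digammaSubLog w = ∑' j : ℕ, logRemainder (w + j) := by
    have ht : Tendsto (fun n : ℕ => (3 : ℂ) + ((1 / ((n : ℝ) + 1) : ℝ) : ℂ)) atTop
        (𝓝[≠] (3 : ℂ)) := by
      refine tendsto_nhdsWithin_iff.2 ⟨?_, Eventually.of_forall fun n => ?_⟩
      · have := (continuous_ofReal.tendsto 0).comp
          (tendsto_one_div_add_atTop_nhds_zero_nat (𝕜 := ℝ))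
        simpa using this.const_add (3 : ℂ)
      · have : (1 / ((n : ℝ) + 1)) ≠ 0 := by positivity
        simpa only [Set.mem_compl_iff, Set.mem_singleton_iff, add_eq_left, ofReal_eq_zero]
    refine ht.frequently (Eventually.of_forall fun n => ?_).frequently
    have := hreal (3 + 1 / ((n : ℝ) + 1))
      (by have : 0 < 1 / ((n : ℝ) + 1) := by positivity
          linarith)
    push_cast at this
    push_cast
    exact this
  exact (hD.analyticOnNhd hopen).eqOn_of_preconnected_of_frequently_eq
    (hS.analyticOnNhd hopen) hconv.isPreconnected (z₀ := 3) (by simp; norm_num) hfreq hz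

theorem tendsto_digammaSubLog_add_natCast {z : ℂ} (hz : 0 < z.re) :
    Tendsto (fun N : ℕ => digammaSubLog (z + N)) atTop (𝓝 0) := by
  have h3 : 2 < (z + 3).re := by simp; linarith
  rw [← tendsto_add_atTop_iff_nat 3]
  have := tendsto_sum_nat_add (fun j : ℕ => logRemainder (z + 3 + j))
  refine this.congr fun N => ?_
  have h4 : 2 < (z + ((N + 3 : ℕ) : ℂ)).re := by simp; linarith [(N.cast_nonneg : (0 : ℝ) ≤ N)]
  rw [digammaSubLog_eq_tsum h4]
  congr 1
  ext j
  push_cast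
  ring_nf

/-- The first term of Stirling's formula for the digamma function, in the first quadrant. -/
theorem norm_digammaSubLog_le {z : ℂ} (hz : 0 < z.re) (ht : 2 ≤ z.im) :
    ‖digammaSubLog z‖ ≤ 4 / z.im := by
  have hsum : ∀ N : ℕ, ‖∑ j ∈ Finset.range N, logRemainder (z + j)‖ ≤
      2 / (z.im - 1) - 2 / (z.im - 1 + N) := by
    intro N
    induction N with
    | zero => simp
    | succ n ih =>
      rw [Finset.sum_range_succ]
      refine (norm_add_le _ _).trans ?_
      have hn : (0 : ℝ) ≤ n := n.cast_nonneg
      have hsq : ‖z + n‖ ^ 2 = (z.re + n) ^ 2 + z.im ^ 2 := by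
        rw [← normSq_eq_norm_sq, normSq_apply]; simp; ring
      have hge : 2 ≤ ‖z + n‖ := by
        refine ht.trans ((le_abs_self _).trans ?_)
        simpa using abs_im_le_norm (z + n)
      have hpos : 0 < (z.im - 1 + n) * (z.im + n) := by
        apply mul_pos <;> linarith
      -- As n² + t² ≥ (n + t)²/2, the squared norm dominates a product whose reciprocal telescopes.
      have hlow : (z.im - 1 + n) * (z.im + n) / 2 ≤ ‖z + n‖ ^ 2 := by
        rw [hsq]; nlinarith [sq_nonneg (z.im - n), mul_nonneg hz.le hn]
      have hr : ‖logRemainder (z + n)‖ ≤ ((z.im - 1 + n) * (z.im + n) / 2)⁻¹ :=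
        (norm_logRemainder_le hge).trans (inv_anti₀ (by positivity) hlow)
      have e : ((z.im - 1 + n) * (z.im + n) / 2)⁻¹ =
          2 / (z.im - 1 + n) - 2 / (z.im - 1 + (n + 1 : ℕ)) := by
        push_cast
        have h1 : z.im - 1 + n ≠ 0 := by linarith
        have h2 : z.im + n ≠ 0 := by linarith
        have h3 : z.im - 1 + (n + 1) ≠ 0 := by linarith
        field_simp
        ring
      linarith
  have hN : ∀ N : ℕ, ‖digammaSubLog z‖ ≤ 2 / (z.im - 1) + ‖digammaSubLog (z + N)‖ := by
    intro N
    conv_lhs => rw [digammaSubLog_eq_sum_add hz N]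
    refine (norm_add_le _ _).trans ?_
    have : 0 ≤ 2 / (z.im - 1 + N) := by
      have : (0 : ℝ) ≤ N := N.cast_nonneg
      apply div_nonneg <;> linarith
    linarith [hsum N]
  have hlim : Tendsto (fun N : ℕ => 2 / (z.im - 1) + ‖digammaSubLog (z + N)‖) atTop
      (𝓝 (2 / (z.im - 1) + 0)) :=
    tendsto_const_nhds.add (by simpa using (tendsto_digammaSubLog_add_natCast hz).norm)
  have h := ge_of_tendsto' hlim hN
  rw [add_zero] at h
  refine h.trans ?_
  rw [div_le_div_iff₀ (by linarith) (by linarith)]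
  linarith

/-! ### Reflection, conjugation, and modulus 1 on the critical line. -/

/-- The reciprocal of `feDelta` off the real line. -/
noncomputable def feDeltaInv (s : ℂ) : ℂ :=
  2 * cos (Real.pi * s / 2) * Gamma s * (2 * Real.pi : ℂ) ^ (-s)

theorem two_pi_ne_zero_complex : (2 * Real.pi : ℂ) ≠ 0 := by
  exact_mod_cast Real.two_pi_pos.ne'

theorem sin_pi_mul_ne_zero_of_im_ne_zero {s : ℂ} (hs : s.im ≠ 0) : sin (Real.pi * s) ≠ 0 := by
  intro h
  obtain ⟨k, hk⟩ := Complex.sin_eq_zero_iff.1 h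
  have hpi : (Real.pi : ℂ) ≠ 0 := by exact_mod_cast Real.pi_ne_zero
  have : s = k := by
    apply mul_left_cancel₀ hpi
    rw [hk, mul_comm]
  apply hs
  rw [this, intCast_im]

theorem sin_pi_mul_eq (s : ℂ) :
    sin (Real.pi * s) = 2 * sin (Real.pi * s / 2) * cos (Real.pi * s / 2) := by
  rw [← Complex.sin_two_mul]
  congr 1
  ring

theorem feDelta_mul_feDeltaInv {s : ℂ} (hs : s.im ≠ 0) : feDelta s * feDeltaInv s = 1 := by
  have hpi : (Real.pi : ℂ) ≠ 0 := by exact_mod_cast Real.pi_ne_zero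
  have hpow : (2 * Real.pi : ℂ) ^ (-s) = 2 ^ (-s) * (Real.pi : ℂ) ^ (-s) := by
    exact_mod_cast Complex.mul_cpow_ofReal_nonneg (a := 2) (b := Real.pi) (by norm_num)
      Real.pi_pos.le (-s)
  have h2 : (2 : ℂ) ^ s * 2 ^ (-s) = 1 := by
    rw [← cpow_add _ _ two_ne_zero, add_neg_cancel, cpow_zero]
  have h3 : (Real.pi : ℂ) ^ (s - 1) * (Real.pi : ℂ) ^ (-s) = (Real.pi : ℂ)⁻¹ := by
    rw [← cpow_add _ _ hpi, show s - 1 + -s = -1 by ring, cpow_neg_one]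
  have hG := Gamma_mul_Gamma_one_sub s
  have hsin := sin_pi_mul_ne_zero_of_im_ne_zero hs
  rw [eq_div_iff hsin, sin_pi_mul_eq] at hG
  calc feDelta s * feDeltaInv s
      = ((2 : ℂ) ^ s * 2 ^ (-s)) * ((Real.pi : ℂ) ^ (s - 1) * (Real.pi : ℂ) ^ (-s)) *
        (Gamma s * Gamma (1 - s) *
          (2 * sin (Real.pi * s / 2) * cos (Real.pi * s / 2))) := by
        rw [feDelta, feDeltaInv, hpow]; ring
    _ = 1 := by rw [h2, h3, hG]; field_simp

theorem feDelta_ne_zero {s : ℂ} (hs : s.im ≠ 0) : feDelta s ≠ 0 :=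
  left_ne_zero_of_mul_eq_one (feDelta_mul_feDeltaInv hs)

theorem feDeltaInv_ne_zero {s : ℂ} (hs : s.im ≠ 0) : feDeltaInv s ≠ 0 :=
  right_ne_zero_of_mul_eq_one (feDelta_mul_feDeltaInv hs)

theorem feDelta_eq_inv {s : ℂ} (hs : s.im ≠ 0) : feDelta s = (feDeltaInv s)⁻¹ :=
  eq_inv_of_mul_eq_one_left (feDelta_mul_feDeltaInv hs)

theorem feDelta_one_sub (s : ℂ) : feDelta (1 - s) = feDeltaInv s := by
  have hpi : (Real.pi : ℂ) ≠ 0 := by exact_mod_cast Real.pi_ne_zero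
  have hpow : (2 * Real.pi : ℂ) ^ (-s) = 2 ^ (-s) * (Real.pi : ℂ) ^ (-s) := by
    exact_mod_cast Complex.mul_cpow_ofReal_nonneg (a := 2) (b := Real.pi) (by norm_num)
      Real.pi_pos.le (-s)
  have hsin : sin (Real.pi * (1 - s) / 2) = cos (Real.pi * s / 2) := by
    rw [← Complex.sin_pi_div_two_sub]; congr 1; ring
  rw [feDelta, feDeltaInv, hpow, hsin, sub_sub_cancel, sub_eq_add_neg 1 s,
    cpow_add _ _ two_ne_zero, cpow_one, show 1 + -s - 1 = -s by ring]
  ring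

theorem conj_two : (starRingEnd ℂ) (2 : ℂ) = 2 := Complex.conj_ofNat 2

theorem feDeltaInv_conj (s : ℂ) :
    feDeltaInv ((starRingEnd ℂ) s) = (starRingEnd ℂ) (feDeltaInv s) := by
  have e1 : (Real.pi : ℂ) * (starRingEnd ℂ) s / 2 = (starRingEnd ℂ) (Real.pi * s / 2) := by
    simp [map_div₀, conj_two]
  have e2 : (2 * Real.pi : ℂ) ^ (-(starRingEnd ℂ) s) =
      (starRingEnd ℂ) ((2 * Real.pi : ℂ) ^ (-s)) := by
    have harg : arg (2 * Real.pi : ℂ) ≠ Real.pi := by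
      have : arg (2 * Real.pi : ℂ) = 0 := by
        exact_mod_cast arg_ofReal_of_nonneg Real.two_pi_pos.le
      rw [this]; exact Real.pi_ne_zero.symm
    have := cpow_conj (2 * Real.pi : ℂ) (-s) harg
    simpa [conj_two] using this
  rw [feDeltaInv, feDeltaInv, e1, e2, Complex.cos_conj, Gamma_conj]
  simp [conj_two]

theorem norm_feDelta_mul_norm {s : ℂ} (hs : s.im ≠ 0) :
    ‖feDelta s‖ * ‖feDelta (1 - (starRingEnd ℂ) s)‖ = 1 := by
  rw [feDelta_one_sub, feDeltaInv_conj, norm_conj, ← norm_mul, feDelta_mul_feDeltaInv hs, norm_one]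

theorem norm_feDelta_critical_line {t : ℝ} (ht : t ≠ 0) : ‖feDelta ⟨1 / 2, t⟩‖ = 1 := by
  have h := norm_feDelta_mul_norm (s := ⟨1 / 2, t⟩) ht
  have e : (1 : ℂ) - (starRingEnd ℂ) ⟨1 / 2, t⟩ = ⟨1 / 2, t⟩ := by
    apply Complex.ext <;> norm_num
  rw [e] at h
  nlinarith [norm_nonneg (feDelta ⟨1 / 2, t⟩)]

/-! ### The logarithmic derivative of Δ. -/

/-- The logarithmic derivative of `feDelta`. -/
noncomputable def feDeltaLogDeriv (s : ℂ) : ℂ :=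
  Real.log (2 * Real.pi) - digamma s + Real.pi / 2 * tan (Real.pi * s / 2)

/-- The sine term is not divided by the cosine, so that the formula also holds at the zeros of
`feDeltaInv`; it is used at the zero 11. -/
theorem hasDerivAt_feDeltaInv {s : ℂ} (hs : 0 < s.re) :
    HasDerivAt feDeltaInv
      (-(Real.pi * sin (Real.pi * s / 2)) * Gamma s * (2 * Real.pi : ℂ) ^ (-s) +
        (digamma s - Real.log (2 * Real.pi)) * feDeltaInv s) s := by
  have hlog : log (2 * Real.pi : ℂ) = Real.log (2 * Real.pi) := by
    have := ofReal_log Real.two_pi_pos.le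
    push_cast at this ⊢
    exact this.symm
  have h1 : HasDerivAt (fun z : ℂ => Real.pi * z / 2) ((Real.pi : ℂ) * 1 / 2) s :=
    ((hasDerivAt_id s).const_mul _).div_const _
  have hcos := (h1.ccos).const_mul (2 : ℂ)
  have hG := (differentiableAt_Gamma s (ne_neg_natCast_of_re_pos hs)).hasDerivAt
  have hp := (hasDerivAt_id s).fun_neg.const_cpow (c := (2 * Real.pi : ℂ))
    (Or.inl two_pi_ne_zero_complex)
  have hdG : deriv Gamma s = digamma s * Gamma s := by
    rw [digamma_def, logDeriv_apply, div_mul_cancel₀ _ (Gamma_ne_zero_of_re_pos hs)]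
  refine ((hcos.mul hG).mul hp).congr_deriv ?_
  rw [hdG, hlog, feDeltaInv]
  simp only [id, Pi.mul_apply]
  ring

theorem cos_pi_mul_ne_zero {s : ℂ} (hs : s.im ≠ 0) : cos (Real.pi * s / 2) ≠ 0 := fun h =>
  sin_pi_mul_ne_zero_of_im_ne_zero hs (by rw [sin_pi_mul_eq, h, mul_zero])

/-- Differentiating the reciprocal brings in Γ(s) instead of Γ(1 − s), and hence ψ in the half-plane
where Stirling's formula has been proved. -/
theorem hasDerivAt_feDelta {s : ℂ} (hs : 0 < s.re) (ht : 0 < s.im) :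
    HasDerivAt feDelta (feDeltaLogDeriv s * feDelta s) s := by
  have h1 := (hasDerivAt_feDeltaInv hs).inv (feDeltaInv_ne_zero ht.ne')
  have h2 : feDelta =ᶠ[𝓝 s] feDeltaInv⁻¹ := by
    filter_upwards [(isOpen_lt continuous_const continuous_im).mem_nhds ht] with z hz
    exact feDelta_eq_inv (ne_of_gt hz)
  refine (h1.congr_of_eventuallyEq h2).congr_deriv ?_
  have hc := cos_pi_mul_ne_zero ht.ne'
  have h0 := feDeltaInv_ne_zero ht.ne'
  have e : (Real.pi * sin (Real.pi * s / 2)) * Gamma s * (2 * Real.pi : ℂ) ^ (-s) =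
      Real.pi / 2 * tan (Real.pi * s / 2) * feDeltaInv s := by
    rw [feDeltaInv, Complex.tan]
    field_simp
  rw [feDelta_eq_inv ht.ne', feDeltaLogDeriv, neg_mul, neg_mul, e]
  field_simp
  ring

theorem im_le_norm_cos {w : ℂ} (hw : 0 ≤ w.im) : w.im ≤ ‖cos w‖ := by
  have h1 : ‖exp (-w * I)‖ = Real.exp w.im := by rw [norm_exp]; simp
  have h2 : ‖exp (w * I)‖ = Real.exp (-w.im) := by rw [norm_exp]; simp
  have h3 := norm_sub_norm_le (exp (-w * I)) (-exp (w * I))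
  rw [norm_neg, h1, h2, sub_neg_eq_add, add_comm] at h3
  have h4 : ‖cos w‖ = ‖exp (w * I) + exp (-w * I)‖ / 2 := by
    rw [Complex.cos, norm_div]; simp
  have h5 := Real.self_le_sinh_iff.2 hw
  rw [Real.sinh_eq] at h5
  linarith

theorem norm_tan_sub_I_le {w : ℂ} (hw : 0 < w.im) : ‖tan w - I‖ ≤ 1 / w.im := by
  have h := im_le_norm_cos hw.le
  have hc : cos w ≠ 0 := fun h0 => by rw [h0, norm_zero] at h; linarith
  have e : tan w - I = -I * exp (w * I) / cos w := by
    rw [Complex.tan, Complex.exp_mul_I]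
    field_simp
    ring_nf
    rw [I_sq]
    ring
  have h2 : ‖exp (w * I)‖ ≤ 1 := by
    rw [norm_exp]; simpa using hw.le
  rw [e, norm_div, norm_mul, norm_neg, norm_I, one_mul]
  exact div_le_div₀ zero_le_one h2 hw h

theorem norm_feDeltaLogDeriv_add_log_le {s : ℂ} (hs : 0 < s.re) (ht : 2 ≤ s.im) :
    ‖feDeltaLogDeriv s + log s - (Real.log (2 * Real.pi) + Real.pi / 2 * I)‖ ≤ 5 / s.im := by
  have hpi := Real.pi_pos
  have him : (Real.pi * s / 2 : ℂ).im = Real.pi * s.im / 2 := by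
    have : (Real.pi * s / 2 : ℂ) = ((Real.pi / 2 : ℝ) : ℂ) * s := by push_cast; ring
    rw [this, im_ofReal_mul]; ring
  have htan := norm_tan_sub_I_le (w := Real.pi * s / 2) (by rw [him]; positivity)
  have e : feDeltaLogDeriv s + log s - (Real.log (2 * Real.pi) + Real.pi / 2 * I) =
      -digammaSubLog s + ((Real.pi / 2 : ℝ) : ℂ) * (tan (Real.pi * s / 2) - I) := by
    rw [feDeltaLogDeriv, digammaSubLog]; push_cast; ring
  rw [e]
  refine (norm_add_le _ _).trans ?_
  rw [norm_neg, norm_mul, norm_real, Real.norm_of_nonneg (by positivity)]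
  have h1 := norm_digammaSubLog_le hs ht
  have h2 : Real.pi / 2 * ‖tan (Real.pi * s / 2) - I‖ ≤ 1 / s.im := by
    refine (mul_le_mul_of_nonneg_left htan (by positivity)).trans (le_of_eq ?_)
    rw [him]
    field_simp
  calc _ ≤ 4 / s.im + 1 / s.im := add_le_add h1 h2
    _ = 5 / s.im := by ring

/-- Only |s| ≥ Im s is used, so the bound is uniform in Re s; this is what allows B = ∞. -/
theorem re_feDeltaLogDeriv_le {s : ℂ} (hs : 0 < s.re) (ht : 2 ≤ s.im) :
    (feDeltaLogDeriv s).re ≤ -Real.log (s.im / (2 * Real.pi)) + 5 / s.im := by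
  have h := (re_le_norm _).trans (norm_feDeltaLogDeriv_add_log_le hs ht)
  have e : (feDeltaLogDeriv s + log s - (Real.log (2 * Real.pi) + Real.pi / 2 * I)).re =
      (feDeltaLogDeriv s).re + Real.log ‖s‖ - Real.log (2 * Real.pi) := by
    have : (Real.pi / 2 * I : ℂ) = ((Real.pi / 2 : ℝ) : ℂ) * I := by push_cast; ring
    rw [this, sub_re, add_re, add_re, ofReal_re, re_ofReal_mul, I_re, log_re]
    ring
  rw [e] at h
  have h2 : Real.log s.im ≤ Real.log ‖s‖ :=
    Real.log_le_log (by linarith) ((le_abs_self _).trans (abs_im_le_norm s))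
  rw [Real.log_div (by linarith) Real.two_pi_pos.ne']
  linarith

theorem norm_log_sub_le {s : ℂ} (hs : 0 < s.re) (hs1 : s.re ≤ 1) (ht : 2 ≤ s.im) :
    ‖log s - (Real.log s.im + Real.pi / 2 * I)‖ ≤ 2 / s.im := by
  have ht0 : 0 < s.im := by linarith
  have htC : (s.im : ℂ) ≠ 0 := by exact_mod_cast ht0.ne'
  -- Factor s = t · i · (1 + w) with w = −iσ/t. Since arg (1 + w) ≤ 0, the logarithm of the product
  -- splits without a correction by 2πi.
  set w : ℂ := ((-(s.re / s.im) : ℝ) : ℂ) * I with hw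
  have e : s = ((s.im : ℝ) : ℂ) * (I * (1 + w)) := by
    apply Complex.ext <;> simp [hw]
    field_simp
  have hwn : ‖w‖ = s.re / s.im := by
    rw [hw, norm_mul, norm_I, mul_one, norm_real, norm_neg, Real.norm_of_nonneg (by positivity)]
  have hwle : ‖w‖ ≤ 1 / s.im := by rw [hwn]; gcongr
  have hhalf : ‖w‖ ≤ 1 / 2 := hwle.trans (by gcongr)
  have h1 : 0 < (1 + w).re := by simp [hw]
  have h10 : 1 + w ≠ 0 := fun h => by rw [h] at h1; simp at h1
  have a1 := abs_lt.1 (abs_arg_lt_pi_div_two_iff.2 (Or.inl h1))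
  have him : (1 + w).im ≤ 0 := by simp [hw]; positivity
  have hlog1 : log (I * (1 + w)) = log I + log (1 + w) := by
    apply log_mul I_ne_zero h10
    rw [arg_I]
    have : arg (1 + w) ≤ 0 := by
      rw [arg_of_re_nonneg h1.le]
      exact Real.arcsin_nonpos.2 (div_nonpos_of_nonpos_of_nonneg him (norm_nonneg _))
    constructor <;> linarith [a1.1, Real.pi_pos]
  have hlog2 : log s = Real.log s.im + (log I + log (1 + w)) := by
    conv_lhs => rw [e]
    rw [log_ofReal_mul ht0 (mul_ne_zero I_ne_zero h10), hlog1]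
  rw [hlog2, log_I, show (Real.log s.im : ℂ) + (Real.pi / 2 * I + log (1 + w)) -
    (Real.log s.im + Real.pi / 2 * I) = log (1 + w) by ring]
  have := norm_log_one_add_half_le_self hhalf
  calc _ ≤ 3 / 2 * ‖w‖ := this
    _ ≤ 2 * (1 / s.im) := by gcongr; norm_num
    _ = 2 / s.im := by ring

theorem norm_feDeltaLogDeriv_add_le {s : ℂ} (hs : 0 < s.re) (hs1 : s.re ≤ 1) (ht : 2 ≤ s.im) :
    ‖feDeltaLogDeriv s + Real.log (s.im / (2 * Real.pi))‖ ≤ 7 / s.im := by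
  have h1 := norm_feDeltaLogDeriv_add_log_le hs ht
  have h2 := norm_log_sub_le hs hs1 ht
  have e : feDeltaLogDeriv s + Real.log (s.im / (2 * Real.pi)) =
      (feDeltaLogDeriv s + log s - (Real.log (2 * Real.pi) + Real.pi / 2 * I)) -
      (log s - (Real.log s.im + Real.pi / 2 * I)) := by
    rw [Real.log_div (by linarith) Real.two_pi_pos.ne']
    push_cast
    ring
  rw [e]
  calc _ ≤ 5 / s.im + 2 / s.im := norm_sub_le_of_le h1 h2
    _ = 7 / s.im := by ring

/-! ### A branch of log Δ. -/

/-- A holomorphic branch of `log feDelta` on the open first quadrant. -/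
theorem exists_log_feDelta : ∃ φ : ℂ → ℂ, ∀ s : ℂ, 0 < s.re → 0 < s.im →
    exp (φ s) = feDelta s ∧ HasDerivAt φ (feDeltaLogDeriv s) s := by
  set U : Set ℂ := {s | 0 < s.re} ∩ {s | 0 < s.im} with hU
  have hUo : IsOpen U := (isOpen_lt continuous_const continuous_re).inter
    (isOpen_lt continuous_const continuous_im)
  have hUc : Convex ℝ U := (convex_halfSpace_re_gt 0).inter (convex_halfSpace_im_gt 0)
  have hne : U.Nonempty := ⟨⟨1, 1⟩, by simp [hU]⟩
  have := hUc.contractibleSpace hne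
  have hsc : IsSimplyConnected U := by unfold IsSimplyConnected; infer_instance
  obtain ⟨φ, hφc, hφ⟩ := exists_continuousOn_eqOn_exp_comp hsc hUo (g := feDelta)
    (fun s hs => (hasDerivAt_feDelta hs.1 hs.2).continuousAt.continuousWithinAt)
    (by rintro ⟨s, hs, h0⟩; exact feDelta_ne_zero (ne_of_gt hs.2) h0)
  have hexp : ∀ s ∈ U, exp (φ s) = feDelta s := fun s hs => hφ hs
  refine ⟨φ, fun s hs ht => ⟨hexp s ⟨hs, ht⟩, ?_⟩⟩
  have hmem : U ∈ 𝓝 s := hUo.mem_nhds ⟨hs, ht⟩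
  have hcont : ContinuousAt φ s := hφc.continuousAt hmem
  have h0 : feDelta s ≠ 0 := feDelta_ne_zero ht.ne'
  -- Continuity keeps Im (φ z − φ s) below π near s, so φ agrees there with a shifted principal
  -- logarithm, which can be differentiated.
  have hlocal : ∀ᶠ z in 𝓝 s, φ z = φ s + log (feDelta z / feDelta s) := by
    have hc : ContinuousAt (fun z => (φ z - φ s).im) s :=
      continuous_im.continuousAt.comp (hcont.sub continuousAt_const)
    have hsmall : ∀ᶠ z in 𝓝 s, |(φ z - φ s).im| < Real.pi := by
      have := hc.abs.eventually_lt (continuousAt_const (y := Real.pi)) (by simp [Real.pi_pos])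
      exact this
    filter_upwards [hsmall, hmem] with z hz hzU
    rw [← hexp z hzU, ← hexp s ⟨hs, ht⟩, ← exp_sub, log_exp (abs_lt.1 hz).1 (abs_lt.1 hz).2.le]
    ring
  have hd : HasDerivAt (fun z => φ s + log (feDelta z / feDelta s)) (feDeltaLogDeriv s) s := by
    have := (((hasDerivAt_feDelta hs ht).div_const (feDelta s)).clog
      (by rw [div_self h0]; exact one_mem_slitPlane)).const_add (φ s)
    refine this.congr_deriv ?_
    rw [div_self h0]
    field_simp
  exact hd.congr_of_eventuallyEq hlocal

/-- A branch of `log feDelta`, holomorphic in the open first quadrant. -/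
noncomputable def logFeDelta : ℂ → ℂ := exists_log_feDelta.choose

theorem exp_logFeDelta {s : ℂ} (hs : 0 < s.re) (ht : 0 < s.im) :
    exp (logFeDelta s) = feDelta s := (exists_log_feDelta.choose_spec s hs ht).1

theorem hasDerivAt_logFeDelta {s : ℂ} (hs : 0 < s.re) (ht : 0 < s.im) :
    HasDerivAt logFeDelta (feDeltaLogDeriv s) s := (exists_log_feDelta.choose_spec s hs ht).2

theorem re_logFeDelta {s : ℂ} (hs : 0 < s.re) (ht : 0 < s.im) :
    (logFeDelta s).re = Real.log ‖feDelta s‖ := by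
  rw [← exp_logFeDelta hs ht, norm_exp, Real.log_exp]

theorem HasDerivAt.comp_complex_line {f : ℂ → ℂ} {f' z v : ℂ} {u : ℝ}
    (h : HasDerivAt f f' (z + u * v)) : HasDerivAt (fun r : ℝ => f (z + r * v)) (f' * v) u := by
  have h1 : HasDerivAt (fun w : ℂ => z + w * v) v (u : ℂ) := by
    simpa using ((hasDerivAt_id (u : ℂ)).mul_const v).const_add z
  exact (h.comp (u : ℂ) h1).comp_ofReal

theorem HasDerivAt.complex_re {f : ℝ → ℂ} {f' : ℂ} {u : ℝ} (h : HasDerivAt f f' u) :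
    HasDerivAt (fun r => (f r).re) f'.re u :=
  (reCLM.hasFDerivAt (x := f u)).comp_hasDerivAt u h

theorem HasDerivAt.complex_im {f : ℝ → ℂ} {f' : ℂ} {u : ℝ} (h : HasDerivAt f f' u) :
    HasDerivAt (fun r => (f r).im) f'.im u :=
  (imCLM.hasFDerivAt (x := f u)).comp_hasDerivAt u h

/-! ### The size of Δ off the critical line. -/

theorem two_le_log_div_two_pi {t : ℝ} (ht : 100 ≤ t) : 2 ≤ Real.log (t / (2 * Real.pi)) := by
  have h1 : Real.exp 2 ≤ 9 := by
    have : Real.exp 2 = Real.exp 1 * Real.exp 1 := by rw [← Real.exp_add]; norm_num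
    rw [this]
    nlinarith [Real.exp_one_lt_d9, Real.exp_pos 1]
  rw [Real.le_log_iff_exp_le (by have := Real.pi_pos; positivity),
    le_div_iff₀ Real.two_pi_pos]
  nlinarith [Real.pi_lt_d2, Real.pi_pos]

theorem re_feDeltaLogDeriv_le_one_sub {s : ℂ} (hs : 0 < s.re) (ht : 100 ≤ s.im) :
    (feDeltaLogDeriv s).re ≤ 1 - Real.log (s.im / (2 * Real.pi)) := by
  have h := re_feDeltaLogDeriv_le hs (by linarith)
  have : 5 / s.im ≤ 1 := by rw [div_le_one (by linarith)]; linarith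
  linarith

/-- Re L' ≤ 1 − log(t/2π) is integrated along the horizontal segment from the critical line, where
log |Δ| vanishes. -/
theorem log_norm_feDelta_le {s : ℂ} (hs : 1 / 2 ≤ s.re) (ht : 100 ≤ s.im) :
    Real.log ‖feDelta s‖ ≤ -((s.re - 1 / 2) * (Real.log (s.im / (2 * Real.pi)) - 1)) := by
  set t := s.im with htdef
  have ht0 : 0 < t := by linarith
  have hre : ∀ x : ℝ, ((t : ℂ) * I + x * 1).re = x := by intro x; simp
  have him : ∀ x : ℝ, ((t : ℂ) * I + x * 1).im = t := by intro x; simp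
  have hd : ∀ x : ℝ, 0 < x → HasDerivAt (fun r : ℝ => (logFeDelta (t * I + r * 1)).re)
      (feDeltaLogDeriv (t * I + x * 1)).re x := by
    intro x hx
    have := (hasDerivAt_logFeDelta (s := t * I + x * 1)
      (by rwa [hre]) (by rwa [him])).comp_complex_line.complex_re
    rwa [mul_one] at this
  have key := (convex_Ioi (0 : ℝ)).image_sub_le_mul_sub_of_deriv_le
    (f := fun r : ℝ => (logFeDelta (t * I + r * 1)).re)
    (fun x hx => (hd x hx).continuousAt.continuousWithinAt)
    (fun x hx => (hd x (by simpa using hx)).differentiableAt.differentiableWithinAt)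
    (C := 1 - Real.log (t / (2 * Real.pi))) (by
      intro x hx
      rw [interior_Ioi] at hx
      rw [(hd x hx).deriv]
      have := re_feDeltaLogDeriv_le_one_sub (s := t * I + x * 1) (by rwa [hre])
        (by rwa [him])
      rwa [him] at this)
    (1 / 2) (by norm_num) s.re (by simp; linarith) hs
  have e1 : (t : ℂ) * I + (s.re : ℝ) * 1 = s := by
    apply Complex.ext <;> simp [htdef]
  have e2 : (t : ℂ) * I + ((1 / 2 : ℝ) : ℂ) * 1 = ⟨1 / 2, t⟩ := by
    apply Complex.ext <;> simp
  simp only [e1, e2] at key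
  rw [re_logFeDelta (s := s) (by linarith) ht0, re_logFeDelta (s := ⟨1 / 2, t⟩) (by norm_num) ht0,
    norm_feDelta_critical_line ht0.ne', Real.log_one] at key
  linarith

/-- Left of the critical line, s ↦ 1 − s̄ inverts |Δ| and reflects back to the right half. -/
theorem abs_re_sub_half_mul_le {s : ℂ} (ht : 100 ≤ s.im) :
    |s.re - 1 / 2| * (Real.log (s.im / (2 * Real.pi)) - 1) ≤ |Real.log ‖feDelta s‖| := by
  rcases le_total (1 / 2) s.re with h | h
  · have := log_norm_feDelta_le h ht
    rw [abs_of_nonneg (by linarith)]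
    exact le_trans (by linarith) (neg_le_abs _)
  · set s' : ℂ := 1 - (starRingEnd ℂ) s with hs'
    have hre : s'.re = 1 - s.re := by simp [hs']
    have him : s'.im = s.im := by simp [hs']
    have h0 : ‖feDelta s‖ ≠ 0 := norm_ne_zero_iff.2 (feDelta_ne_zero (by linarith))
    have h1 : ‖feDelta s'‖ ≠ 0 := norm_ne_zero_iff.2 (feDelta_ne_zero (by rw [him]; linarith))
    have hm := congrArg Real.log (norm_feDelta_mul_norm (s := s) (by linarith))
    rw [Real.log_mul h0 h1, Real.log_one] at hm
    have := log_norm_feDelta_le (s := s') (by rw [hre]; linarith) (by rwa [him])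
    rw [hre, him] at this
    rw [abs_of_nonpos (by linarith)]
    exact le_trans (by linarith) (le_abs_self _)

theorem tendsto_log_div_two_pi :
    Tendsto (fun t : ℝ => Real.log (t / (2 * Real.pi))) atTop atTop :=
  Real.tendsto_log_atTop.comp (tendsto_id.atTop_div_const Real.two_pi_pos)

/-- The `a`-points of `feDelta` approach the critical line. -/
theorem exists_height_abs_re_sub_half_lt (a : ℂ) {ε : ℝ} (hε : 0 < ε) :
    ∃ T : ℝ, 100 ≤ T ∧ ∀ s : ℂ, T ≤ s.im → feDelta s = a → |s.re - 1 / 2| < ε := by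
  obtain ⟨T, hT⟩ := eventually_atTop.1
    (tendsto_log_div_two_pi.eventually_gt_atTop (|Real.log ‖a‖| / ε + 1))
  refine ⟨max T 100, le_max_right _ _, fun s hs hsa => ?_⟩
  have h1 := hT s.im ((le_max_left _ _).trans hs)
  have h2 := abs_re_sub_half_mul_le ((le_max_right _ _).trans hs)
  rw [hsa] at h2
  have h3 : |Real.log ‖a‖| < ε * (Real.log (s.im / (2 * Real.pi)) - 1) := by
    rw [mul_comm, ← div_lt_iff₀ hε]
    linarith
  have h4 : 0 < Real.log (s.im / (2 * Real.pi)) - 1 := by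
    have : 0 ≤ |Real.log ‖a‖| / ε := by positivity
    linarith
  exact lt_of_mul_lt_mul_right (h2.trans_lt h3) h4.le

/-! ### Injectivity of log Δ. -/

/-- A form of the Noshiro–Warschawski theorem. -/
theorem Convex.injOn_of_re_deriv_neg {S : Set ℂ} (hS : Convex ℝ S) {f f' : ℂ → ℂ}
    (hf : ∀ z ∈ S, HasDerivAt f (f' z) z) (hneg : ∀ z ∈ S, (f' z).re < 0) : Set.InjOn f S := by
  intro z hz w hw hfzw
  by_contra hne
  have hv : w - z ≠ 0 := sub_ne_zero.2 (Ne.symm hne)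
  have hmem : ∀ u ∈ Set.Icc (0 : ℝ) 1, z + u * (w - z) ∈ S := by
    intro u hu
    have := hS.add_smul_sub_mem hz hw hu
    rwa [real_smul] at this
  have hd : ∀ u ∈ Set.Icc (0 : ℝ) 1,
      HasDerivAt (fun r : ℝ => (f (z + r * (w - z)) / (w - z)).re) (f' (z + u * (w - z))).re u := by
    intro u hu
    have := ((hf _ (hmem u hu)).comp_complex_line.div_const (w - z)).complex_re
    rwa [mul_div_cancel_right₀ _ hv] at this
  -- Rolle's theorem: after division by w − z, the real part along the segment has derivative Re f'
  -- and equal values at the ends.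
  obtain ⟨u, hu, h0⟩ := exists_hasDerivAt_eq_zero zero_lt_one
    (fun u hu => (hd u hu).continuousAt.continuousWithinAt) (by simp [hfzw])
    (fun u hu => hd u (Set.Ioo_subset_Icc_self hu))
  exact (hneg _ (hmem u (Set.Ioo_subset_Icc_self hu))).ne h0

theorem injOn_logFeDelta : Set.InjOn logFeDelta {s | 0 < s.re ∧ 100 ≤ s.im} := by
  have hconv : Convex ℝ {s : ℂ | 0 < s.re ∧ 100 ≤ s.im} :=
    (convex_halfSpace_re_gt 0).inter (convex_halfSpace_im_ge 100)
  refine hconv.injOn_of_re_deriv_neg (fun z hz => hasDerivAt_logFeDelta hz.1 (by linarith [hz.2]))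
    (fun z hz => ?_)
  linarith [re_feDeltaLogDeriv_le_one_sub hz.1 hz.2, two_le_log_div_two_pi hz.2]

/-! ### The argument of Δ on the critical line. -/

/-- The continuous argument of `feDelta` along the critical line
(minus twice the Riemann–Siegel theta function, up to a constant). -/
noncomputable def criticalArg (t : ℝ) : ℝ := (logFeDelta (1 / 2 + t * I)).im

theorem half_add_mul_I_re (t : ℝ) : (1 / 2 + t * I : ℂ).re = 1 / 2 := by simp

theorem half_add_mul_I_im (t : ℝ) : (1 / 2 + t * I : ℂ).im = t := by simp

theorem hasDerivAt_criticalArg {t : ℝ} (ht : 0 < t) :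
    HasDerivAt criticalArg (feDeltaLogDeriv (1 / 2 + t * I)).re t := by
  have := (hasDerivAt_logFeDelta (s := 1 / 2 + t * I) (by rw [half_add_mul_I_re]; norm_num)
    (by rwa [half_add_mul_I_im])).comp_complex_line.complex_im
  rwa [mul_I_im] at this

theorem abs_deriv_criticalArg_add_le {t : ℝ} (ht : 2 ≤ t) :
    |(feDeltaLogDeriv (1 / 2 + t * I)).re + Real.log (t / (2 * Real.pi))| ≤ 7 / t := by
  have h := (abs_re_le_norm _).trans (norm_feDeltaLogDeriv_add_le (s := 1 / 2 + t * I)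
    (by rw [half_add_mul_I_re]; norm_num) (by rw [half_add_mul_I_re]; norm_num)
    (by rwa [half_add_mul_I_im]))
  rwa [half_add_mul_I_im, add_re, ofReal_re] at h

theorem logFeDelta_critical_line {t : ℝ} (ht : 0 < t) :
    logFeDelta (1 / 2 + t * I) = criticalArg t * I := by
  have hre := re_logFeDelta (s := 1 / 2 + t * I) (by rw [half_add_mul_I_re]; norm_num)
    (by rwa [half_add_mul_I_im])
  have e : (1 / 2 + t * I : ℂ) = ⟨1 / 2, t⟩ := by
    apply Complex.ext <;> simp
  rw [e, norm_feDelta_critical_line ht.ne', Real.log_one, ← e] at hre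
  apply Complex.ext
  · rw [hre]; simp
  · simp [criticalArg]

/-- The main term `t log (t / 2πe)`. -/
noncomputable def mainTerm (t : ℝ) : ℝ := t * Real.log (t / (2 * Real.pi * Real.exp 1))

theorem hasDerivAt_mainTerm {t : ℝ} (ht : 0 < t) :
    HasDerivAt mainTerm (Real.log (t / (2 * Real.pi))) t := by
  have hc : 2 * Real.pi * Real.exp 1 ≠ 0 := by positivity
  have h := (hasDerivAt_id t).mul (((hasDerivAt_id t).div_const (2 * Real.pi * Real.exp 1)).log
    (by simp only [id]; positivity))
  refine h.congr_deriv ?_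
  simp only [id]
  rw [← div_div, Real.log_div (by positivity) (Real.exp_pos 1).ne', Real.log_exp]
  field_simp
  ring

theorem abs_le_add_mul_log_of_abs_deriv_le {f f' : ℝ → ℝ} {A c : ℝ} (hA : 1 ≤ A) (hc : 0 ≤ c)
    (hf : ∀ t, A ≤ t → HasDerivAt f (f' t) t) (hb : ∀ t, A ≤ t → |f' t| ≤ c / t) {T : ℝ}
    (hT : A ≤ T) : |f T| ≤ |f A| + c * Real.log T := by
  have hd : ∀ t, A ≤ t → HasDerivAt (fun t => |f A| + c * Real.log t) (c * t⁻¹) t := fun t ht =>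
    ((Real.hasDerivAt_log (by linarith)).const_mul c).const_add _
  exact image_norm_le_of_norm_deriv_right_le_deriv_boundary' (f := f) (f' := f') (a := A) (b := T)
    (fun t ht => (hf t ht.1).continuousAt.continuousWithinAt)
    (fun t ht => (hf t ht.1).hasDerivWithinAt)
    (B := fun t => |f A| + c * Real.log t) (B' := fun t => c * t⁻¹)
    (by have := Real.log_nonneg hA
        rw [Real.norm_eq_abs]
        nlinarith [mul_nonneg hc this])
    (fun t ht => (hd t ht.1).continuousAt.continuousWithinAt)
    (fun t ht => (hd t ht.1).hasDerivWithinAt)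
    (fun t ht => by rw [Real.norm_eq_abs, ← div_eq_mul_inv]; exact hb t ht.1)
    (Set.right_mem_Icc.2 hT)

/-- The derivatives −log(t/2π) + O(1/t) and log(t/2π) cancel up to 7/t, which integrates to 7 log T.
-/
theorem exists_abs_criticalArg_add_mainTerm_le :
    ∃ C : ℝ, ∀ T : ℝ, 100 ≤ T → |criticalArg T + mainTerm T| ≤ C + 7 * Real.log T :=
  ⟨_, fun _ hT => abs_le_add_mul_log_of_abs_deriv_le (f := fun t => criticalArg t + mainTerm t)
    (by norm_num) (by norm_num)
    (fun _ ht => (hasDerivAt_criticalArg (by linarith)).add (hasDerivAt_mainTerm (by linarith)))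
    (fun _ ht => abs_deriv_criticalArg_add_le (by linarith)) hT⟩

theorem criticalArg_sub_le {t u : ℝ} (ht : 100 ≤ t) (htu : t ≤ u) :
    criticalArg u - criticalArg t ≤ t - u := by
  have hd : ∀ x : ℝ, 100 ≤ x → HasDerivAt criticalArg (feDeltaLogDeriv (1 / 2 + x * I)).re x :=
    fun x hx => hasDerivAt_criticalArg (by linarith)
  have := (convex_Ici (100 : ℝ)).image_sub_le_mul_sub_of_deriv_le (f := criticalArg)
    (fun x hx => (hd x hx).continuousAt.continuousWithinAt)
    (fun x hx => (hd x (interior_subset hx)).differentiableAt.differentiableWithinAt)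
    (C := -1) (by
      intro x hx
      have hx' : 100 ≤ x := interior_subset hx
      rw [(hd x hx').deriv]
      have h1 := re_feDeltaLogDeriv_le_one_sub (s := 1 / 2 + x * I)
        (by rw [half_add_mul_I_re]; norm_num) (by rwa [half_add_mul_I_im])
      rw [half_add_mul_I_im] at h1
      linarith [two_le_log_div_two_pi hx'])
    t ht u (ht.trans htu) htu
  linarith

/-- The cost of stopping at height T − 1 in the lower bound for the count. -/
theorem criticalArg_sub_one_sub_le {T : ℝ} (hT : 101 ≤ T) :
    criticalArg (T - 1) - criticalArg T ≤ Real.log T := by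
  have hd : ∀ x : ℝ, 100 ≤ x → HasDerivAt criticalArg (feDeltaLogDeriv (1 / 2 + x * I)).re x :=
    fun x hx => hasDerivAt_criticalArg (by linarith)
  obtain ⟨x, hx, he⟩ := exists_hasDerivAt_eq_slope criticalArg
    (fun x => (feDeltaLogDeriv (1 / 2 + x * I)).re) (a := T - 1) (b := T) (by linarith)
    (fun x hx => (hd x (by linarith [hx.1])).continuousAt.continuousWithinAt)
    (fun x hx => hd x (by linarith [hx.1]))
  have hx0 : 100 ≤ x := by linarith [hx.1]
  rw [sub_sub_cancel, div_one] at he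
  have h1 := (abs_le.1 (abs_deriv_criticalArg_add_le (t := x) (by linarith))).1
  have h2 : 7 / x ≤ 1 := by rw [div_le_one (by linarith)]; linarith
  -- The extra 1 is absorbed because e < 2π.
  have h3 : Real.log (x / (2 * Real.pi)) + 1 ≤ Real.log T := by
    rw [← Real.log_exp 1, ← Real.log_mul (by have := Real.pi_pos; positivity) (Real.exp_pos 1).ne']
    apply Real.log_le_log (by have := Real.pi_pos; positivity)
    rw [div_mul_eq_mul_div, div_le_iff₀ Real.two_pi_pos]
    nlinarith [hx.2, Real.pi_gt_three, Real.exp_one_lt_d9, Real.exp_pos 1]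
  linarith

theorem continuousOn_criticalArg : ContinuousOn criticalArg (Set.Ici 100) := fun x hx =>
  (hasDerivAt_criticalArg (lt_of_lt_of_le (by norm_num) hx)).continuousAt.continuousWithinAt

/-! ### Local surjectivity of log Δ near the critical line. -/

theorem abs_log_sub_log_le {x t : ℝ} (ht : 101 ≤ t) (hx : |x - t| ≤ 1 / 4) :
    |Real.log x - Real.log t| ≤ 1 / 4 := by
  obtain ⟨h1, h2⟩ := abs_le.1 hx
  have hx0 : 0 < x := by linarith
  have ht0 : 0 < t := by linarith
  have a1 := Real.log_le_sub_one_of_pos (div_pos hx0 ht0)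
  have a2 := Real.log_le_sub_one_of_pos (div_pos ht0 hx0)
  rw [Real.log_div hx0.ne' ht0.ne'] at a1
  rw [Real.log_div ht0.ne' hx0.ne'] at a2
  have b1 : x / t ≤ 1 + 1 / 4 := by rw [div_le_iff₀ ht0]; linarith
  have b2 : t / x ≤ 1 + 1 / 4 := by rw [div_le_iff₀ hx0]; linarith
  rw [abs_le]
  constructor <;> linarith

theorem norm_feDeltaLogDeriv_add_le_one {s : ℂ} {t : ℝ} (ht : 101 ≤ t)
    (hs : ‖s - (1 / 2 + t * I)‖ ≤ 1 / 4) :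
    0 < s.re ∧ 100 ≤ s.im ∧ ‖feDeltaLogDeriv s + Real.log (t / (2 * Real.pi))‖ ≤ 1 := by
  have hre := (abs_re_le_norm _).trans hs
  have him := (abs_im_le_norm _).trans hs
  rw [sub_re, half_add_mul_I_re] at hre
  rw [sub_im, half_add_mul_I_im] at him
  have hre' := abs_le.1 hre
  have him' := abs_le.1 him
  have h1 : 0 < s.re := by linarith
  have h2 : 100 ≤ s.im := by linarith
  refine ⟨h1, h2, ?_⟩
  have h3 := norm_feDeltaLogDeriv_add_le h1 (by linarith) (by linarith)
  have h4 : 7 / s.im ≤ 1 / 4 := by rw [div_le_div_iff₀ (by linarith) (by norm_num)]; linarith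
  have h5 := abs_log_sub_log_le ht him
  have e : feDeltaLogDeriv s + Real.log (t / (2 * Real.pi)) =
      (feDeltaLogDeriv s + Real.log (s.im / (2 * Real.pi))) -
        ((Real.log s.im - Real.log t : ℝ) : ℂ) := by
    rw [Real.log_div (by linarith) Real.two_pi_pos.ne',
      Real.log_div (by linarith) Real.two_pi_pos.ne']
    push_cast
    ring
  rw [e]
  refine (norm_sub_le _ _).trans ?_
  rw [norm_real, Real.norm_eq_abs]
  linarith

/-- A quantitative inverse function theorem: on the disc, L differs from multiplication by −λ, λ =
log(t/2π), by a map with Lipschitz constant 1, so the image of a disc of radius ρ covers one of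
radius (λ − 1)ρ. -/
theorem exists_logFeDelta_eq_of_le {ρ t : ℝ} (hρ : 0 < ρ) (hρ' : ρ ≤ 1 / 4) (ht : 101 ≤ t)
    {w : ℂ} (hw : ‖w - logFeDelta (1 / 2 + t * I)‖ ≤ (Real.log (t / (2 * Real.pi)) - 1) * ρ) :
    ∃ s : ℂ, ‖s - (1 / 2 + t * I)‖ ≤ ρ ∧ logFeDelta s = w := by
  set lam := Real.log (t / (2 * Real.pi)) with hlam
  have hlam2 : 2 ≤ lam := two_le_log_div_two_pi (by linarith)
  have hlamC : (lam : ℂ) ≠ 0 := by exact_mod_cast (by linarith : lam ≠ 0)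
  set A : ℂ →L[ℂ] ℂ := (-(lam : ℂ)) • ContinuousLinearMap.id ℂ ℂ with hA
  let R : A.NonlinearRightInverse :=
    { toFun := fun y => (-(lam : ℂ))⁻¹ * y
      nnnorm := ⟨lam⁻¹, by positivity⟩
      bound' := fun y => by
        rw [norm_mul, norm_inv, norm_neg, norm_real, Real.norm_of_nonneg (by linarith)]
        exact le_rfl
      right_inv' := fun y => by
        simp [hA, hlamC] }
  have hball : ∀ s ∈ Metric.closedBall (1 / 2 + t * I : ℂ) ρ, ‖s - (1 / 2 + t * I)‖ ≤ 1 / 4 :=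
    fun s hs => (mem_closedBall_iff_norm.1 hs).trans hρ'
  have happ : ApproximatesLinearOn logFeDelta A (Metric.closedBall (1 / 2 + t * I : ℂ) ρ) 1 := by
    intro x hx y hy
    have hd : ∀ s ∈ Metric.closedBall (1 / 2 + t * I : ℂ) ρ, HasDerivWithinAt
        (fun s => logFeDelta s + lam * s) (feDeltaLogDeriv s + lam * 1)
        (Metric.closedBall (1 / 2 + t * I : ℂ) ρ) s := by
      intro s hs
      obtain ⟨h1, h2, -⟩ := norm_feDeltaLogDeriv_add_le_one ht (hball s hs)
      exact ((hasDerivAt_logFeDelta h1 (by linarith)).add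
        ((hasDerivAt_id s).const_mul _)).hasDerivWithinAt
    have := (convex_closedBall _ _).norm_image_sub_le_of_norm_hasDerivWithin_le hd (C := 1)
      (fun s hs => by
        rw [mul_one]; exact (norm_feDeltaLogDeriv_add_le_one ht (hball s hs)).2.2) hy hx
    refine le_trans (le_of_eq ?_) this
    congr 1
    simp [hA]
    ring
  have hsurj := happ.surjOn_closedBall_of_nonlinearRightInverse R hρ.le subset_rfl
  have hw' : w ∈ Metric.closedBall (logFeDelta (1 / 2 + t * I))
      (((R.nnnorm : ℝ)⁻¹ - (1 : NNReal)) * ρ) := by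
    rw [mem_closedBall_iff_norm]
    have : (R.nnnorm : ℝ)⁻¹ = lam := inv_inv lam
    rw [this]
    exact hw
  obtain ⟨s, hs, hsw⟩ := hsurj hw'
  exact ⟨s, mem_closedBall_iff_norm.1 hs, hsw⟩

/-- Above a certain height there is an `a`-point near each point of the critical line where
`feDelta` has the argument of `a`. -/
theorem exists_height_exists_feDelta_eq {a : ℂ} (ha : a ≠ 0) {ρ : ℝ} (hρ : 0 < ρ)
    (hρ' : ρ ≤ 1 / 4) : ∃ T : ℝ, 101 ≤ T ∧ ∀ t, T ≤ t → ∀ m : ℤ,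
      criticalArg t = a.arg - m * (2 * Real.pi) →
        ∃ s : ℂ, ‖s - (1 / 2 + t * I)‖ ≤ ρ ∧ feDelta s = a ∧
          logFeDelta s = log a - m * (2 * Real.pi * I) := by
  obtain ⟨T, hT⟩ := eventually_atTop.1
    (tendsto_log_div_two_pi.eventually_ge_atTop (|Real.log ‖a‖| / ρ + 1))
  refine ⟨max T 101, le_max_right _ _, fun t ht m hm => ?_⟩
  have h101 : 101 ≤ t := (le_max_right _ _).trans ht
  have h1 := hT t ((le_max_left _ _).trans ht)
  obtain ⟨s, hs, hsw⟩ := exists_logFeDelta_eq_of_le hρ hρ' h101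
    (w := log a - m * (2 * Real.pi * I)) (by
      -- Arguments match, so the target differs from L on the line only by the fixed real number log
      -- |a|, while the covered radius grows without bound.
      have e : log a - m * (2 * Real.pi * I) - logFeDelta (1 / 2 + t * I) =
          ((Real.log ‖a‖ : ℝ) : ℂ) := by
        rw [logFeDelta_critical_line (by linarith), hm, Complex.log]
        push_cast
        ring
      rw [e, norm_real, Real.norm_eq_abs, ← div_le_iff₀ hρ]
      linarith)
  refine ⟨s, hs, ?_, hsw⟩
  obtain ⟨p1, p2, -⟩ := norm_feDeltaLogDeriv_add_le_one h101 (hs.trans hρ')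
  rw [← exp_logFeDelta p1 (by linarith), hsw, exp_sub, exp_log ha, exp_int_mul_two_pi_mul_I,
    div_one]

/-- With λ = log(t/2π) ≥ 2, the mean value inequality costs (λ + 1)|σ − 1/2| ≤ 3(λ − 1)|σ − 1/2|. At
an `a`-point this becomes a constant, so the argument can be read off on the critical line. -/
theorem abs_im_logFeDelta_sub_criticalArg_le {s : ℂ} (hs : |s.re - 1 / 2| < 1 / 4)
    (ht : 100 ≤ s.im) :
    |(logFeDelta s).im - criticalArg s.im| ≤ 3 * |Real.log ‖feDelta s‖| := by
  set lam := Real.log (s.im / (2 * Real.pi)) with hlam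
  have hlam2 : 2 ≤ lam := two_le_log_div_two_pi ht
  have hs' := abs_lt.1 hs
  set S : Set ℂ := ({z | 0 < z.re} ∩ {z | z.re ≤ 1}) ∩ {z | z.im = s.im} with hS
  have hSc : Convex ℝ S := ((convex_halfSpace_re_gt 0).inter (convex_halfSpace_re_le 1)).inter
    (convex_hyperplane (Complex.imLm.isLinear) _)
  have hmem1 : s ∈ S := ⟨⟨(by linarith : 0 < s.re), (by linarith : s.re ≤ 1)⟩, rfl⟩
  have hmem2 : (1 / 2 + s.im * I : ℂ) ∈ S := by
    have hre := half_add_mul_I_re s.im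
    exact ⟨⟨(by rw [hre]; norm_num : 0 < (1 / 2 + s.im * I : ℂ).re),
      (by rw [hre]; norm_num : (1 / 2 + s.im * I : ℂ).re ≤ 1)⟩, half_add_mul_I_im s.im⟩
  have hlip := hSc.norm_image_sub_le_of_norm_hasDerivWithin_le (f := logFeDelta)
    (f' := feDeltaLogDeriv) (C := lam + 1)
    (fun z hz => (hasDerivAt_logFeDelta hz.1.1
      (by rw [show z.im = s.im from hz.2]; linarith)).hasDerivWithinAt)
    (fun z hz => by
      have him : z.im = s.im := hz.2
      have h1 := norm_feDeltaLogDeriv_add_le hz.1.1 hz.1.2 (by rw [him]; linarith)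
      rw [him] at h1
      have h2 : 7 / s.im ≤ 1 := by rw [div_le_one (by linarith)]; linarith
      have h3 := norm_sub_le (feDeltaLogDeriv z + (lam : ℂ)) lam
      rw [add_sub_cancel_right, norm_real, Real.norm_of_nonneg (by linarith)] at h3
      linarith) hmem2 hmem1
  have hdist : ‖s - (1 / 2 + s.im * I)‖ = |s.re - 1 / 2| := by
    have : s - (1 / 2 + s.im * I) = ((s.re - 1 / 2 : ℝ) : ℂ) := by
      apply Complex.ext <;> simp
    rw [this, norm_real, Real.norm_eq_abs]
  rw [hdist] at hlip
  have h1 := abs_re_sub_half_mul_le ht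
  have h2 : (lam + 1) * |s.re - 1 / 2| ≤ 3 * |Real.log ‖feDelta s‖| := by
    nlinarith [abs_nonneg (s.re - 1 / 2)]
  have h3 := (abs_im_le_norm _).trans (hlip.trans h2)
  rwa [sub_im] at h3

/-! ### Counting `a`-points above a certain height. -/

theorem antitoneOn_criticalArg : AntitoneOn criticalArg (Set.Ici 100) := fun t ht u _ htu => by
  linarith [criticalArg_sub_le ht htu]

theorem ncard_Icc_ceil_floor_bounds {x y : ℝ} (hxy : x ≤ y) :
    y - x - 1 ≤ ((Set.Icc ⌈x⌉ ⌊y⌋).ncard : ℝ) ∧ ((Set.Icc ⌈x⌉ ⌊y⌋).ncard : ℝ) ≤ y - x + 1 := by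
  have hcard : (Set.Icc ⌈x⌉ ⌊y⌋).ncard = (⌊y⌋ + 1 - ⌈x⌉).toNat := by
    rw [← Finset.coe_Icc, Set.ncard_coe_finset, Int.card_Icc]
  have hf1 := Int.floor_le y
  have hf2 := Int.lt_floor_add_one y
  have hc1 := Int.le_ceil x
  have hc2 := Int.ceil_lt_add_one x
  rw [hcard]
  have hcast : (((⌊y⌋ + 1 - ⌈x⌉).toNat : ℕ) : ℝ) = max ((⌊y⌋ : ℝ) + 1 - ⌈x⌉) 0 := by
    have := Int.toNat_eq_max (⌊y⌋ + 1 - ⌈x⌉)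
    have h2 : (((⌊y⌋ + 1 - ⌈x⌉).toNat : ℤ) : ℝ) = ((max (⌊y⌋ + 1 - ⌈x⌉) 0 : ℤ) : ℝ) := by
      rw [this]
    push_cast at h2
    exact h2
  rw [hcast]
  refine ⟨le_max_of_le_left (by linarith), max_le (by linarith) (by linarith)⟩

theorem exists_int_logFeDelta_eq {a s : ℂ} (ha : a ≠ 0) (hs : 0 < s.re) (ht : 0 < s.im)
    (hsa : feDelta s = a) : ∃ m : ℤ, logFeDelta s = log a - m * (2 * Real.pi * I) := by
  have h := exp_logFeDelta hs ht
  rw [hsa, ← exp_log ha] at h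
  obtain ⟨n, hn⟩ := exp_eq_exp_iff_exists_int.1 h
  refine ⟨-n, ?_⟩
  rw [hn]
  push_cast
  ring

theorem int_eq_of_log_sub_eq {a : ℂ} {m n : ℤ}
    (h : log a - m * (2 * Real.pi * I) = log a - n * (2 * Real.pi * I)) : m = n := by
  have := mul_right_cancel₀ Complex.two_pi_I_ne_zero (sub_right_injective h)
  exact_mod_cast this

theorem im_log_sub (a : ℂ) (m : ℤ) :
    (log a - m * (2 * Real.pi * I)).im = a.arg - m * (2 * Real.pi) := by
  have : (m * (2 * Real.pi * I) : ℂ) = ((m * (2 * Real.pi) : ℝ) : ℂ) * I := by push_cast; ring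
  rw [this, sub_im, log_im, im_ofReal_mul, I_im, mul_one]

/-- The asymptotic count of the `a`-points above a certain height. -/
theorem exists_height_ncard_aPoints {a : ℂ} (ha : a ≠ 0) {B : EReal}
    (hB : ((1 / 2 : ℝ) : EReal) < B) : ∃ T₁ : ℝ, 100 ≤ T₁ ∧ ∀ T₀, T₁ ≤ T₀ → ∃ C : ℝ,
      ∀ T, T₀ + 2 ≤ T → (aPoints a T₀ B T).Finite ∧
        |((aPoints a T₀ B T).ncard : ℝ) - mainTerm T / (2 * Real.pi)| ≤ C + 2 * Real.log T := by
  obtain ⟨b, hb, hbB⟩ := EReal.lt_iff_exists_real_btwn.1 hB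
  have hb' : 1 / 2 < b := by exact_mod_cast hb
  -- Solutions within ρ of the critical line have real part below b, hence below B, and height
  -- within 1/4 of the prescribed one.
  set ρ := min (1 / 4) ((b - 1 / 2) / 2) with hρdef
  have hρ : 0 < ρ := lt_min (by norm_num) (by linarith)
  have hρ4 : ρ ≤ 1 / 4 := min_le_left _ _
  have hρb : ρ ≤ (b - 1 / 2) / 2 := min_le_right _ _
  obtain ⟨Ta, hTa, hclose⟩ := exists_height_abs_re_sub_half_lt a (ε := 1 / 4) (by norm_num)
  obtain ⟨Tb, hTb, hsolve⟩ := exists_height_exists_feDelta_eq ha hρ hρ4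
  obtain ⟨C₀, hC₀⟩ := exists_abs_criticalArg_add_mainTerm_le
  refine ⟨max Ta Tb, hTa.trans (le_max_left _ _), fun T₀ hT₀ => ?_⟩
  have hT₀a : Ta ≤ T₀ := (le_max_left _ _).trans hT₀
  have hT₀b : Tb ≤ T₀ := (le_max_right _ _).trans hT₀
  have h2pi := Real.two_pi_pos
  set D := 3 * |Real.log ‖a‖| with hD
  have hD0 : 0 ≤ D := by positivity
  refine ⟨|criticalArg T₀| + |criticalArg (T₀ + 1)| + |C₀| + 2 * D + 1, fun T hT => ?_⟩
  have hlogT : 0 ≤ Real.log T := Real.log_nonneg (by linarith)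
  have hmain := abs_le.1 (hC₀ T (by linarith))
  have hpi3 := Real.pi_gt_three
  -- the integer attached to an `a`-point
  have hex : ∀ s ∈ aPoints a T₀ B T, ∃ m : ℤ, logFeDelta s = log a - m * (2 * Real.pi * I) := by
    rintro s ⟨hsa, -, -, h3, -⟩
    have := abs_lt.1 (hclose s (by linarith) hsa)
    exact exists_int_logFeDelta_eq ha (by linarith) (by linarith) hsa
  choose! N hN using hex
  -- The integers of all `a`-points lie in [x, y]; D allows for the change of argument between the
  -- `a`-point and the critical line.
  set x := (a.arg - criticalArg T₀ - D) / (2 * Real.pi) with hx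
  set y := (a.arg - criticalArg T + D) / (2 * Real.pi) with hy
  have hmaps : Set.MapsTo N (aPoints a T₀ B T) (Set.Icc ⌈x⌉ ⌊y⌋) := by
    intro s hs
    obtain ⟨hsa, -, -, h3, h4⟩ := id hs
    have hcl := hclose s (by linarith) hsa
    have hle := abs_le.1 (abs_im_logFeDelta_sub_criticalArg_le hcl (by linarith))
    rw [hsa, hN s hs, im_log_sub] at hle
    have hm1 := antitoneOn_criticalArg (a := T₀) (b := s.im) (by simp; linarith)
      (by simp; linarith) h3.le
    have hm2 := antitoneOn_criticalArg (a := s.im) (b := T) (by simp; linarith)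
      (by simp; linarith) h4.le
    rw [Set.mem_Icc, Int.ceil_le, Int.le_floor, hx, hy, div_le_iff₀ h2pi, le_div_iff₀ h2pi]
    constructor <;> linarith [hle.1, hle.2]
  have hinj : Set.InjOn N (aPoints a T₀ B T) := by
    intro s hs s' hs' heq
    have e1 := hN s hs
    have e2 := hN s' hs'
    rw [heq, ← e2] at e1
    have mem : ∀ z ∈ aPoints a T₀ B T, 0 < z.re ∧ 100 ≤ z.im := by
      rintro z ⟨hza, -, -, h3, -⟩
      have := abs_lt.1 (hclose z (by linarith) hza)
      exact ⟨by linarith, by linarith⟩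
    exact injOn_logFeDelta (mem s hs) (mem s' hs') e1
  have hfin : (aPoints a T₀ B T).Finite := Set.Finite.of_injOn hmaps hinj (Set.finite_Icc _ _)
  refine ⟨hfin, ?_⟩
  have hup := Set.ncard_le_ncard_of_injOn N hmaps hinj (Set.finite_Icc _ _)
  have hanti := antitoneOn_criticalArg (a := T₀) (b := T) (by simp; linarith)
      (by simp; linarith) (by linarith)
  have hcard := (ncard_Icc_ceil_floor_bounds (x := x) (y := y) (by
    rw [hx, hy]; gcongr ?_ / _; linarith)).2
  have hup' : ((aPoints a T₀ B T).ncard : ℝ) ≤ y - x + 1 := le_trans (by exact_mod_cast hup) hcard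
  -- the `a`-point attached to an integer
  set x' := (a.arg - criticalArg (T₀ + 1)) / (2 * Real.pi) with hx'
  set y' := (a.arg - criticalArg (T - 1)) / (2 * Real.pi) with hy'
  have hex' : ∀ m ∈ Set.Icc ⌈x'⌉ ⌊y'⌋, ∃ s ∈ aPoints a T₀ B T,
      logFeDelta s = log a - m * (2 * Real.pi * I) := by
    intro m hm
    rw [Set.mem_Icc, Int.ceil_le, Int.le_floor, hx', hy', div_le_iff₀ h2pi,
      le_div_iff₀ h2pi] at hm
    obtain ⟨t, ht, htm⟩ := intermediate_value_Icc' (show T₀ + 1 ≤ T - 1 by linarith)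
      (continuousOn_criticalArg.mono fun u hu => by simp only [Set.mem_Ici]; linarith [hu.1])
      (show a.arg - m * (2 * Real.pi) ∈ _ from ⟨by linarith [hm.2], by linarith [hm.1]⟩)
    obtain ⟨s, hs, hsa, hsl⟩ := hsolve t (by linarith [ht.1]) m htm
    have hre := abs_le.1 ((abs_re_le_norm _).trans hs)
    have him := abs_le.1 ((abs_im_le_norm _).trans hs)
    rw [sub_re, half_add_mul_I_re] at hre
    rw [sub_im, half_add_mul_I_im] at him
    refine ⟨s, ⟨hsa, by linarith, lt_trans ?_ hbB, by linarith [ht.1], by linarith [ht.2]⟩, hsl⟩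
    exact_mod_cast (show s.re < b by linarith)
  choose! Z hZ hZl using hex'
  have hlow := Set.ncard_le_ncard_of_injOn Z hZ (by
    intro m hm n hn heq
    have e1 := hZl m hm
    rw [heq, hZl n hn] at e1
    exact (int_eq_of_log_sub_eq e1).symm) hfin
  have hanti' := antitoneOn_criticalArg (a := T₀ + 1) (b := T - 1) (by simp; linarith)
      (by simp; linarith) (by linarith)
  have hcard' := (ncard_Icc_ceil_floor_bounds (x := x') (y := y') (by
    rw [hx', hy']; gcongr ?_ / _; linarith)).1
  have hlow' : y' - x' - 1 ≤ ((aPoints a T₀ B T).ncard : ℝ) :=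
    le_trans hcard' (by exact_mod_cast hlow)
  have hstep := criticalArg_sub_one_sub_le (T := T) (by linarith)
  have hyx : y - x = (criticalArg T₀ - criticalArg T + 2 * D) / (2 * Real.pi) := by
    rw [hx, hy]; ring
  have hyx' : y' - x' = (criticalArg (T₀ + 1) - criticalArg (T - 1)) / (2 * Real.pi) := by
    rw [hx', hy']; ring
  rw [hyx] at hup'
  rw [hyx'] at hlow'
  have b1 := le_abs_self (criticalArg T₀)
  have b2 := neg_abs_le (criticalArg (T₀ + 1))
  have b3 := le_abs_self C₀
  have n1 := abs_nonneg (criticalArg T₀)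
  have n2 := abs_nonneg (criticalArg (T₀ + 1))
  have n3 := abs_nonneg C₀
  -- The 8 is 7 from the main term and 1 from the unit step at T; division by 2π brings it below 2.
  set E := |criticalArg T₀| + |criticalArg (T₀ + 1)| + |C₀| + 2 * D + 8 * Real.log T with hE
  have hE0 : 0 ≤ E := by positivity
  have hE1 : E / (2 * Real.pi) ≤ |criticalArg T₀| + |criticalArg (T₀ + 1)| + |C₀| + 2 * D +
      2 * Real.log T := by
    rw [div_le_iff₀ h2pi, hE]
    nlinarith
  have u1 : (criticalArg T₀ - criticalArg T + 2 * D) / (2 * Real.pi) ≤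
      mainTerm T / (2 * Real.pi) + E / (2 * Real.pi) := by
    rw [← add_div]; exact div_le_div_of_nonneg_right (by linarith [hmain.1]) h2pi.le
  have u2 : mainTerm T / (2 * Real.pi) - E / (2 * Real.pi) ≤
      (criticalArg (T₀ + 1) - criticalArg (T - 1)) / (2 * Real.pi) := by
    rw [← sub_div]; exact div_le_div_of_nonneg_right (by linarith [hmain.2]) h2pi.le
  rw [abs_le]
  constructor <;> linarith

/-! ### Finiteness in bounded regions. -/

theorem feDeltaInv_mul_eq_one {a s : ℂ} (hs : s.im ≠ 0) (hsa : feDelta s = a) :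
    a * feDeltaInv s = 1 := hsa ▸ feDelta_mul_feDeltaInv hs

/-- The `a`-points in a bounded region are finite in number. -/
theorem finite_aPoints_inter_re_le (a : ℂ) {t₀ : ℝ} (ht₀ : 0 ≤ t₀) (B : EReal) (T b : ℝ) :
    (aPoints a t₀ B T ∩ {s | s.re ≤ b}).Finite := by
  by_contra hinf
  -- This is s(s + 1)(a · `feDeltaInv` s − 1): the factor removes the poles of Γ at 0 and −1, so F
  -- is holomorphic around the closed rectangle even where that meets the real axis.
  set F : ℂ → ℂ := fun s =>
    a * (2 * cos (Real.pi * s / 2) * Gamma (s + 2) * (2 * Real.pi : ℂ) ^ (-s)) - s * (s + 1) with hF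
  set U : Set ℂ := {s | -2 < s.re} with hU
  have hUo : IsOpen U := isOpen_lt continuous_const continuous_re
  have hUc : IsPreconnected U := (convex_halfSpace_re_gt (-2)).isPreconnected
  have hFd : DifferentiableOn ℂ F U := by
    intro s hs
    have hs' : 0 < (s + 2).re := by
      have : -2 < s.re := hs
      simp; linarith
    have hG : DifferentiableAt ℂ (fun z : ℂ => Gamma (z + 2)) s :=
      (differentiableAt_Gamma _ (ne_neg_natCast_of_re_pos hs')).comp s
        (differentiableAt_id.add_const (2 : ℂ))
    have hp : DifferentiableAt ℂ (fun z : ℂ => (2 * Real.pi : ℂ) ^ (-z)) s :=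
      differentiableAt_id.fun_neg.const_cpow (Or.inl two_pi_ne_zero_complex)
    have hc : DifferentiableAt ℂ (fun z : ℂ => cos (Real.pi * z / 2)) s := by fun_prop
    exact (((((hc.const_mul 2).mul hG).mul hp).const_mul a).sub
      (differentiableAt_id.mul (differentiableAt_id.add_const 1))).differentiableWithinAt
  have hzero : ∀ s ∈ aPoints a t₀ B T, F s = 0 := by
    rintro s ⟨hsa, -, -, him, -⟩
    have him' : s.im ≠ 0 := by linarith
    have h0 : s ≠ 0 := by rintro rfl; simp at him'
    have h1 : s + 1 ≠ 0 := by
      intro h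
      apply him'
      simpa using congrArg Complex.im h
    have hG : Gamma (s + 2) = (s + 1) * (s * Gamma s) := by
      rw [← Gamma_add_one s h0, ← Gamma_add_one (s + 1) h1]
      congr 1; ring
    have h := feDeltaInv_mul_eq_one him' hsa
    rw [feDeltaInv] at h
    simp only [hF]
    rw [hG]
    linear_combination (s * (s + 1)) * h
  set K : Set ℂ := Set.Icc (-1 : ℝ) b ×ℂ Set.Icc t₀ T with hK
  have hKc : IsCompact K := isCompact_Icc.reProdIm isCompact_Icc
  have hsub : aPoints a t₀ B T ∩ {s | s.re ≤ b} ⊆ K := by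
    rintro s ⟨⟨-, h1, -, h2, h3⟩, h4⟩
    exact ⟨⟨h1.le, h4⟩, ⟨h2.le, h3.le⟩⟩
  obtain ⟨z, hzK, hz⟩ := Set.Infinite.exists_accPt_of_subset_isCompact hinf hKc hsub
  have hzU : z ∈ U := by
    have : -1 ≤ z.re := hzK.1.1
    show -2 < z.re
    linarith
  have hfreq : ∃ᶠ w in 𝓝[≠] z, F w = 0 :=
    (accPt_iff_frequently_nhdsNE.1 hz).mono fun w hw => hzero w hw.1
  -- Evaluation at 1, where the cosine vanishes, gives F(1) = −2, so F is not identically zero.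
  have h1 := (hFd.analyticOnNhd hUo).eqOn_zero_of_preconnected_of_frequently_eq_zero hUc hzU hfreq
    (show (1 : ℂ) ∈ U by simp [hU]; norm_num)
  have hcos : cos (Real.pi * 1 / 2) = 0 := by
    rw [mul_one]; exact Complex.cos_pi_div_two
  simp only [hF, hcos, Pi.zero_apply] at h1
  norm_num at h1

/-! ### `a`-points far to the right at bounded height. -/

/-- The factor in the recursion of `feDeltaInv`. -/
noncomputable def recFactor (s : ℂ) : ℂ := -(s * (s + 1)) / (4 * Real.pi ^ 2)

theorem feDeltaInv_add_two {s : ℂ} (hs : 0 < s.re) :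
    feDeltaInv (s + 2) = feDeltaInv s * recFactor s := by
  have h0 : s ≠ 0 := by rintro rfl; simp at hs
  have h1 : s + 1 ≠ 0 := by
    intro h
    have := congrArg Complex.re h
    simp at this
    linarith
  have hpi : (Real.pi : ℂ) ≠ 0 := by exact_mod_cast Real.pi_ne_zero
  have hG : Gamma (s + 2) = (s + 1) * (s * Gamma s) := by
    rw [← Gamma_add_one s h0, ← Gamma_add_one (s + 1) h1]
    congr 1; ring
  have hc : cos (Real.pi * (s + 2) / 2) = -cos (Real.pi * s / 2) := by
    rw [← Complex.cos_add_pi]; congr 1; ring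
  have hp : (2 * Real.pi : ℂ) ^ (-(s + 2)) = (2 * Real.pi : ℂ) ^ (-s) / (2 * Real.pi) ^ 2 := by
    rw [neg_add, ← sub_eq_add_neg, cpow_sub _ _ two_pi_ne_zero_complex, cpow_ofNat]
  rw [feDeltaInv, feDeltaInv, hG, hc, hp, recFactor]
  field_simp
  ring

theorem feDeltaInv_add_two_mul {s : ℂ} (hs : 0 < s.re) (k : ℕ) :
    feDeltaInv (s + 2 * k) = feDeltaInv s * ∏ j ∈ Finset.range k, recFactor (s + 2 * j) := by
  induction k with
  | zero => simp
  | succ n ih =>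
    have h : 0 < (s + 2 * n).re := by simp; positivity
    rw [Finset.prod_range_succ, ← mul_assoc, ← ih, ← feDeltaInv_add_two h]
    push_cast
    ring_nf

theorem four_mul_pi_sq_pos : 0 < 4 * Real.pi ^ 2 := by positivity

theorem norm_recFactor (s : ℂ) : ‖recFactor s‖ = ‖s‖ * ‖s + 1‖ / (4 * Real.pi ^ 2) := by
  have : (4 * Real.pi ^ 2 : ℂ) = ((4 * Real.pi ^ 2 : ℝ) : ℂ) := by push_cast; ring
  rw [recFactor, norm_div, norm_neg, norm_mul, this, norm_real, Real.norm_of_nonneg (by positivity)]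

theorem two_le_norm_recFactor {s : ℂ} (hs : 10 ≤ s.re) : 2 ≤ ‖recFactor s‖ := by
  have h1 : 10 ≤ ‖s‖ := hs.trans (re_le_norm s)
  have h2 : 10 ≤ ‖s + 1‖ := by
    refine le_trans ?_ (re_le_norm (s + 1))
    simp; linarith
  rw [norm_recFactor, le_div_iff₀ four_mul_pi_sq_pos]
  nlinarith [Real.pi_lt_d2, Real.pi_pos]

/-- The numerator of the difference is 2t(2σ + 1) in modulus, while |s(s + 1)| ≥ σ(σ + 1) ≥ 2(2σ +
1) once σ ≥ 10. -/
theorem norm_recFactor_conj_div_sub_one_le {s : ℂ} (hs : 10 ≤ s.re) (ht : 0 ≤ s.im) :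
    ‖recFactor ((starRingEnd ℂ) s) / recFactor s - 1‖ ≤ s.im := by
  have h1 : s.re ≤ ‖s‖ := re_le_norm s
  have h2 : s.re + 1 ≤ ‖s + 1‖ := by simpa using re_le_norm (s + 1)
  have hs0 : s ≠ 0 := norm_pos_iff.1 (by linarith)
  have hs1 : s + 1 ≠ 0 := norm_pos_iff.1 (by linarith)
  have hpi : (Real.pi : ℂ) ≠ 0 := by exact_mod_cast Real.pi_ne_zero
  have e : recFactor ((starRingEnd ℂ) s) / recFactor s - 1 =
      ((-(2 * s.im * (2 * s.re + 1)) : ℝ) : ℂ) * I / (s * (s + 1)) := by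
    have hc : (starRingEnd ℂ) s = s - 2 * s.im * I := by
      apply Complex.ext
      · simp
      · simp; ring
    have hr : ((s.re : ℝ) : ℂ) = s - s.im * I := by
      rw [eq_sub_iff_add_eq]; exact re_add_im s
    rw [recFactor, recFactor]
    field_simp
    rw [hc]
    push_cast
    rw [hr]
    ring
  have hre0 : 0 ≤ s.re := by linarith
  rw [e, norm_div, norm_mul, norm_I, mul_one, norm_real, norm_neg,
    Real.norm_of_nonneg (by positivity), norm_mul, div_le_iff₀ (by apply mul_pos <;> linarith)]
  have : s.re * (s.re + 1) ≤ ‖s‖ * ‖s + 1‖ := by gcongr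
  have h3 : 2 * (2 * s.re + 1) ≤ ‖s‖ * ‖s + 1‖ := by nlinarith
  linarith [mul_le_mul_of_nonneg_left h3 ht]

theorem feDeltaInv_ne_zero_of_mem_strip {s : ℂ} (h1 : 10 ≤ s.re) (h2 : s.re ≤ 12) (h : s ≠ 11) :
    feDeltaInv s ≠ 0 := by
  have hpi : (Real.pi : ℂ) ≠ 0 := by exact_mod_cast Real.pi_ne_zero
  refine mul_ne_zero (mul_ne_zero (mul_ne_zero two_ne_zero fun hc => ?_)
    (Gamma_ne_zero_of_re_pos (by linarith))) ?_
  · obtain ⟨k, hk⟩ := Complex.cos_eq_zero_iff.1 hc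
    have hs : s = ((2 * k + 1 : ℤ) : ℂ) := by
      push_cast
      field_simp at hk
      exact hk
    rw [hs, intCast_re] at h1 h2
    have h1' : 10 ≤ 2 * k + 1 := by exact_mod_cast h1
    have h2' : 2 * k + 1 ≤ 12 := by exact_mod_cast h2
    apply h
    rw [hs, show k = 5 by omega]
    norm_num
  · rw [cpow_ne_zero_iff]
    exact Or.inl two_pi_ne_zero_complex

theorem cos_pi_mul_eleven : cos (Real.pi * 11 / 2) = 0 :=
  Complex.cos_eq_zero_iff.2 ⟨5, by push_cast; ring⟩

/-- The only zero of `feDeltaInv` in the strip 10 ≤ Re s ≤ 12 is simple; strict differentiability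
will separate a point from its conjugate. -/
theorem exists_hasStrictDerivAt_feDeltaInv_eleven :
    ∃ d : ℂ, d ≠ 0 ∧ HasStrictDerivAt feDeltaInv d 11 := by
  have hopen : IsOpen {s : ℂ | 0 < s.re} := isOpen_lt continuous_const continuous_re
  have hd : DifferentiableOn ℂ feDeltaInv {s : ℂ | 0 < s.re} := fun s hs =>
    (hasDerivAt_feDeltaInv hs).differentiableAt.differentiableWithinAt
  have h11 : (11 : ℂ) ∈ {s : ℂ | 0 < s.re} := by
    show 0 < (11 : ℂ).re
    norm_num
  have hstrict := (hd.analyticOnNhd hopen 11 h11).hasStrictDerivAt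
  refine ⟨_, ?_, hstrict⟩
  have hzero : feDeltaInv 11 = 0 := by
    rw [feDeltaInv, cos_pi_mul_eleven]; ring
  rw [(hasDerivAt_feDeltaInv h11).deriv, hzero, mul_zero, add_zero]
  have hpi : (Real.pi : ℂ) ≠ 0 := by exact_mod_cast Real.pi_ne_zero
  have hsin : sin (Real.pi * 11 / 2) ≠ 0 := by
    intro h
    have := Complex.sin_sq_add_cos_sq (Real.pi * 11 / 2 : ℂ)
    rw [h, cos_pi_mul_eleven] at this
    norm_num at this
  refine mul_ne_zero (mul_ne_zero (neg_ne_zero.2 (mul_ne_zero hpi hsin))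
    (Gamma_ne_zero_of_re_pos h11)) ?_
  rw [cpow_ne_zero_iff]
  exact Or.inl two_pi_ne_zero_complex

theorem norm_feDeltaInv_mul_two_pow_le {s : ℂ} (hs : 10 ≤ s.re) (k : ℕ) :
    ‖feDeltaInv s‖ * 2 ^ k ≤ ‖feDeltaInv (s + 2 * k)‖ := by
  rw [feDeltaInv_add_two_mul (by linarith), norm_mul, norm_prod]
  gcongr
  calc (2 : ℝ) ^ k = ∏ j ∈ Finset.range k, (2 : ℝ) := by simp
    _ ≤ _ := Finset.prod_le_prod (fun _ _ => by norm_num) fun j _ =>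
      two_le_norm_recFactor (by
        have : (0 : ℝ) ≤ j := j.cast_nonneg
        simp; linarith)

/-- A far translate of a point where `feDelta` takes a given value is close to the pole. -/
theorem exists_forall_norm_sub_eleven_lt (a : ℂ) (T : ℝ) {δ : ℝ} (hδ : 0 < δ) :
    ∃ K : ℕ, ∀ k, K ≤ k → ∀ s : ℂ, 10 ≤ s.re → s.re ≤ 12 → 0 ≤ s.im → s.im ≤ T →
      a * feDeltaInv (s + 2 * k) = 1 → ‖s - 11‖ < δ := by
  -- Away from 11, |`feDeltaInv`| has a positive minimum on the rectangle, and k translations by 2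
  -- multiply it by at least 2^k, beyond 1/|a|.
  set E : Set ℂ := (Set.Icc (10 : ℝ) 12 ×ℂ Set.Icc 0 T) \ Metric.ball 11 δ with hE
  have hEc : IsCompact E := (isCompact_Icc.reProdIm isCompact_Icc).diff Metric.isOpen_ball
  have hcont : ContinuousOn (fun s => ‖feDeltaInv s‖) E := by
    intro s hs
    have : 10 ≤ s.re := hs.1.1.1
    exact (hasDerivAt_feDeltaInv (by linarith)).continuousAt.norm.continuousWithinAt
  have hpos : ∀ s ∈ E, 0 < ‖feDeltaInv s‖ := by
    rintro s ⟨hs, hb⟩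
    refine norm_pos_iff.2 (feDeltaInv_ne_zero_of_mem_strip hs.1.1 hs.1.2 ?_)
    rintro rfl
    exact hb (Metric.mem_ball_self hδ)
  obtain ⟨m, hm, hmE⟩ : ∃ m : ℝ, 0 < m ∧ ∀ s ∈ E, m ≤ ‖feDeltaInv s‖ := by
    rcases E.eq_empty_or_nonempty with h | h
    · exact ⟨1, one_pos, by simp [h]⟩
    · obtain ⟨z, hz, hmin⟩ := hEc.exists_isMinOn h hcont
      exact ⟨_, hpos z hz, fun s hs => hmin hs⟩
  obtain ⟨K, hK⟩ := pow_unbounded_of_one_lt (‖a‖⁻¹ / m) (one_lt_two (α := ℝ))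
  refine ⟨K, fun k hk s h1 h2 h3 h4 hsa => ?_⟩
  by_contra hge
  have hsE : s ∈ E := ⟨⟨⟨h1, h2⟩, ⟨h3, h4⟩⟩, by
    rw [Metric.mem_ball, dist_eq_norm]; exact hge⟩
  have hn : ‖feDeltaInv (s + 2 * k)‖ = ‖a‖⁻¹ := by
    rw [eq_inv_of_mul_eq_one_right hsa, norm_inv]
  have h5 := norm_feDeltaInv_mul_two_pow_le h1 k
  rw [hn] at h5
  rw [div_lt_iff₀ hm] at hK
  have h6 : (2 : ℝ) ^ K ≤ 2 ^ k := pow_le_pow_right₀ (by norm_num) hk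
  have h7 := hmE s hsE
  have h8 : (2 : ℝ) ^ K * m ≤ ‖feDeltaInv s‖ * 2 ^ k := by
    rw [mul_comm]
    gcongr
  linarith

theorem exp_quarter_le : Real.exp (1 / 4) ≤ 4 / 3 := by
  have h := Real.one_sub_le_exp_neg (1 / 4)
  rw [Real.exp_neg] at h
  have := inv_anti₀ (by norm_num) h
  rw [inv_inv] at this
  linarith [this, (by norm_num : (1 - 1 / 4 : ℝ)⁻¹ = 4 / 3)]

theorem exp_sub_one_le_mul_exp (x : ℝ) : Real.exp x - 1 ≤ x * Real.exp x := by
  have h := mul_le_mul_of_nonneg_right (Real.one_sub_le_exp_neg x) (Real.exp_pos x).le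
  rw [← Real.exp_add, neg_add_cancel, Real.exp_zero] at h
  linarith

/-- Near a far pole, `feDelta` takes real values only on the real line. -/
theorem exists_forall_im_eq_zero {a : ℂ} (ha : a ≠ 0) (hreal : a.im = 0) (T : ℝ) :
    ∃ K : ℕ, ∀ k, K ≤ k → ∀ s : ℂ, 10 ≤ s.re → s.re ≤ 12 → 0 ≤ s.im → s.im ≤ T →
      a * feDeltaInv (s + 2 * k) = 1 → s.im = 0 := by
  obtain ⟨d, hd, hstrict⟩ := exists_hasStrictDerivAt_feDeltaInv_eleven
  have hd' : 0 < ‖d‖ := norm_pos_iff.2 hd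
  have ha' : 0 < ‖a‖ := norm_pos_iff.2 ha
  have hlo := (hstrict.hasStrictFDerivAt.isLittleO).def (c := ‖d‖ / 2) (by positivity)
  obtain ⟨δ, hδ, hball⟩ := Metric.eventually_nhds_iff.1 hlo
  obtain ⟨K₁, hK₁⟩ := exists_forall_norm_sub_eleven_lt a T
    (lt_min hδ (by norm_num : (0 : ℝ) < 1 / 4))
  -- The ratio 2/3 is 4/3, a bound for exp (1/4), divided by the growth factor 2 of the recursion.
  have hlim := tendsto_self_mul_const_pow_of_lt_one (r := (2 / 3 : ℝ)) (by norm_num) (by norm_num)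
  obtain ⟨K₂, hK₂⟩ := eventually_atTop.1
    (hlim.eventually_lt_const (show 0 < ‖d‖ * ‖a‖ by positivity))
  refine ⟨max K₁ K₂, fun k hk s h1 h2 h3 h4 hsa => ?_⟩
  by_contra him
  have him' : 0 < s.im := lt_of_le_of_ne h3 (Ne.symm him)
  have hnear := hK₁ k ((le_max_left _ _).trans hk) s h1 h2 h3 h4 hsa
  have hsmall := hK₂ k ((le_max_right _ _).trans hk)
  set c : ℂ := (starRingEnd ℂ) s with hc
  have hnearc : ‖c - 11‖ = ‖s - 11‖ := by
    rw [← norm_conj (s - 11), map_sub, Complex.conj_ofNat]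
  have hcs : ‖s - c‖ = 2 * s.im := by
    have : s - c = ((2 * s.im : ℝ) : ℂ) * I := by
      rw [hc]
      apply Complex.ext
      · simp
      · simp; ring
    rw [this, norm_mul, norm_I, mul_one, norm_real, Real.norm_of_nonneg (by positivity)]
  have hdiff := hball (y := (s, c)) (by
    rw [Prod.dist_eq, max_lt_iff, dist_eq_norm, dist_eq_norm, hnearc]
    exact ⟨hnear.trans_le (min_le_left _ _), hnear.trans_le (min_le_left _ _)⟩)
  simp only [ContinuousLinearMap.toSpanSingleton_apply, smul_eq_mul] at hdiff
  -- The linear term has size 2‖d‖ Im s and the error at most half of that.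
  have hlower : ‖d‖ * s.im ≤ ‖feDeltaInv s - feDeltaInv c‖ := by
    have h5 := norm_sub_norm_le ((s - c) * d) ((s - c) * d - (feDeltaInv s - feDeltaInv c))
    rw [sub_sub_cancel, norm_sub_rev ((s - c) * d), norm_mul, hcs] at h5
    rw [hcs] at hdiff
    linarith
  have hquarter : s.im ≤ 1 / 4 := by
    have h5 := (abs_im_le_norm (s - 11)).trans (hnear.le.trans (min_le_right _ _))
    have h6 : (s - 11).im = s.im := by simp
    rw [h6] at h5
    exact (le_abs_self _).trans h5
  -- comparison with the reflected point
  set P : ℂ → ℂ := fun z => ∏ j ∈ Finset.range k, recFactor (z + 2 * j) with hP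
  have hcre : c.re = s.re := by simp [hc]
  -- For real a the conjugate of the translated point is an `a`-point too, so both recursion
  -- products end at 1/a.
  have hmul : feDeltaInv s * P s = feDeltaInv c * P c := by
    have e1 := feDeltaInv_add_two_mul (s := s) (by linarith) k
    have e2 := feDeltaInv_add_two_mul (s := c) (by rw [hcre]; linarith) k
    have e3 : c + 2 * k = (starRingEnd ℂ) (s + 2 * k) := by
      rw [hc]; simp [Complex.conj_ofNat]
    have e4 : (starRingEnd ℂ) a = a := conj_eq_iff_im.2 hreal
    have e5 : feDeltaInv (c + 2 * k) = feDeltaInv (s + 2 * k) := by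
      rw [e3, feDeltaInv_conj, eq_inv_of_mul_eq_one_right hsa, map_inv₀, e4]
    simp only [hP]
    rw [← e1, ← e2, e5]
  have hjre : ∀ j : ℕ, 10 ≤ (s + 2 * j).re := by
    intro j
    have : (0 : ℝ) ≤ j := j.cast_nonneg
    simp; linarith
  have hrec0 : ∀ j : ℕ, recFactor (s + 2 * j) ≠ 0 := fun j =>
    norm_pos_iff.1 (lt_of_lt_of_le two_pos (two_le_norm_recFactor (hjre j)))
  have hP0 : P s ≠ 0 := Finset.prod_ne_zero_iff.2 fun j _ => hrec0 j
  have hratio : ‖P c / P s - 1‖ ≤ Real.exp (k * s.im) - 1 := by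
    have e : P c / P s = ∏ j ∈ Finset.range k,
        (1 + (recFactor (c + 2 * j) / recFactor (s + 2 * j) - 1)) := by
      simp only [hP, ← Finset.prod_div_distrib, add_sub_cancel]
    rw [e]
    refine (Finset.norm_prod_one_add_sub_one_le _ _).trans ?_
    gcongr
    calc _ ≤ ∑ j ∈ Finset.range k, s.im := by
          refine Finset.sum_le_sum fun j _ => ?_
          have e3 : c + 2 * j = (starRingEnd ℂ) (s + 2 * j) := by
            rw [hc]; simp [Complex.conj_ofNat]
          have e6 : (s + 2 * j).im = s.im := by simp
          have := norm_recFactor_conj_div_sub_one_le (hjre j) (by rw [e6]; exact h3)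
          rwa [e6, ← e3] at this
      _ = k * s.im := by simp
  have hsub : feDeltaInv s - feDeltaInv c = feDeltaInv c * (P c / P s - 1) := by
    field_simp
    linear_combination hmul
  have hnc : ‖feDeltaInv c‖ = ‖feDeltaInv s‖ := by rw [hc, feDeltaInv_conj, norm_conj]
  have hup : ‖feDeltaInv s‖ * 2 ^ k ≤ ‖a‖⁻¹ := by
    have := norm_feDeltaInv_mul_two_pow_le h1 k
    rwa [eq_inv_of_mul_eq_one_right hsa, norm_inv] at this
  have hexp : Real.exp (k * s.im) - 1 ≤ k * s.im * (4 / 3) ^ k := by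
    refine (exp_sub_one_le_mul_exp _).trans ?_
    gcongr
    calc Real.exp (k * s.im) = Real.exp s.im ^ k := by rw [← Real.exp_nat_mul]
      _ ≤ (4 / 3) ^ k := by
        gcongr
        exact (Real.exp_le_exp.2 hquarter).trans exp_quarter_le
  rw [hsub, norm_mul, hnc] at hlower
  -- The two estimates of the same difference both carry a factor Im s; cancelling it leaves a lower
  -- bound ‖d‖ against a quantity tending to 0 with k.
  have h9 : ‖d‖ * s.im ≤ ‖feDeltaInv s‖ * (k * s.im * (4 / 3) ^ k) :=
    hlower.trans (by gcongr; exact hratio.trans hexp)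
  have h10 : ‖d‖ ≤ ‖feDeltaInv s‖ * 2 ^ k * (k * (2 / 3) ^ k) := by
    have e : ‖feDeltaInv s‖ * (k * s.im * (4 / 3) ^ k) =
        ‖feDeltaInv s‖ * 2 ^ k * (k * (2 / 3) ^ k) * s.im := by
      rw [show (4 / 3 : ℝ) = 2 * (2 / 3) by norm_num, mul_pow]; ring
    rw [e] at h9
    exact le_of_mul_le_mul_right h9 him'
  have h11 : ‖d‖ ≤ ‖a‖⁻¹ * (k * (2 / 3) ^ k) := h10.trans (by gcongr)
  rw [inv_mul_eq_div, le_div_iff₀ ha'] at h11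
  linarith

theorem exists_re_le_of_mem_aPoints {a : ℂ} (ha : a ≠ 0) {t₀ : ℝ} (ht₀ : 0 ≤ t₀)
    (h : 0 < t₀ ∨ a.im = 0) (B : EReal) (T : ℝ) : ∃ b : ℝ, ∀ s ∈ aPoints a t₀ B T, s.re ≤ b := by
  obtain ⟨K, hK⟩ : ∃ K : ℕ, ∀ k, K ≤ k → ∀ s : ℂ, 10 ≤ s.re → s.re ≤ 12 → 0 ≤ s.im → s.im ≤ T →
      a * feDeltaInv (s + 2 * k) = 1 → s.im ≤ t₀ := by
    rcases h with h | h
    · obtain ⟨K, hK⟩ := exists_forall_norm_sub_eleven_lt a T h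
      refine ⟨K, fun k hk s h1 h2 h3 h4 h5 => ?_⟩
      have h6 := (abs_im_le_norm (s - 11)).trans (hK k hk s h1 h2 h3 h4 h5).le
      rw [sub_im, im_ofNat, sub_zero] at h6
      exact (le_abs_self _).trans h6
    · obtain ⟨K, hK⟩ := exists_forall_im_eq_zero ha h T
      exact ⟨K, fun k hk s h1 h2 h3 h4 h5 => (hK k hk s h1 h2 h3 h4 h5).le.trans ht₀⟩
  refine ⟨10 + 2 * K, ?_⟩
  rintro s ⟨hsa, -, -, h3, h4⟩
  by_contra! hre
  -- Translation by −2k brings the real part into [10, 12).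
  set k : ℕ := ⌊(s.re - 10) / 2⌋₊ with hk
  have hf1 : (k : ℝ) ≤ (s.re - 10) / 2 :=
    Nat.floor_le (by have : (0 : ℝ) ≤ K := K.cast_nonneg
                     linarith)
  have hf2 : (s.re - 10) / 2 < k + 1 := Nat.lt_floor_add_one _
  have hKk : K ≤ k := Nat.le_floor (by linarith)
  have him : (s - 2 * k).im = s.im := by simp
  have hre' : (s - 2 * k).re = s.re - 2 * k := by simp
  have := hK k hKk (s - 2 * k) (by rw [hre']; linarith) (by rw [hre']; linarith)
    (by rw [him]; linarith) (by rw [him]; linarith)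
    (by rw [sub_add_cancel]; exact feDeltaInv_mul_eq_one (by linarith) hsa)
  rw [him] at this
  linarith

theorem finite_aPoints {a : ℂ} (ha : a ≠ 0) {t₀ : ℝ} {B : EReal} (ht₀ : 0 ≤ t₀)
    (h : 0 < t₀ ∨ B < ⊤ ∨ a.im = 0) (T : ℝ) : (aPoints a t₀ B T).Finite := by
  obtain ⟨b, hb⟩ : ∃ b : ℝ, ∀ s ∈ aPoints a t₀ B T, s.re ≤ b := by
    rcases h with h | h | h
    · exact exists_re_le_of_mem_aPoints ha ht₀ (Or.inl h) B T
    · obtain ⟨b, hb, -⟩ := EReal.lt_iff_exists_real_btwn.1 h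
      refine ⟨b, fun s hs => ?_⟩
      have := hs.2.2.1.trans hb
      exact_mod_cast this.le
    · exact exists_re_le_of_mem_aPoints ha ht₀ (Or.inr h) B T
  exact (finite_aPoints_inter_re_le a ht₀ B T b).subset fun s hs => ⟨hs, hb s hs⟩

/-! ### Multiplicities and the full count. -/

/-- At such heights Re (Δ'/Δ) < 0, so Δ' does not vanish. -/
theorem analyticOrderNatAt_feDelta_sub {a s : ℂ} (hs : 0 < s.re) (ht : 100 ≤ s.im)
    (hsa : feDelta s = a) : analyticOrderNatAt (fun z : ℂ => feDelta z - a) s = 1 := by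
  have ht0 : 0 < s.im := by linarith
  have hopen : IsOpen ({z : ℂ | 0 < z.re} ∩ {z : ℂ | 0 < z.im}) :=
    (isOpen_lt continuous_const continuous_re).inter (isOpen_lt continuous_const continuous_im)
  have hd : DifferentiableOn ℂ feDelta ({z : ℂ | 0 < z.re} ∩ {z : ℂ | 0 < z.im}) := fun z hz =>
    (hasDerivAt_feDelta hz.1 hz.2).differentiableAt.differentiableWithinAt
  have hderiv : deriv feDelta s ≠ 0 := by
    rw [(hasDerivAt_feDelta hs ht0).deriv]
    refine mul_ne_zero (fun h => ?_) (feDelta_ne_zero ht0.ne')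
    have := re_feDeltaLogDeriv_le_one_sub hs ht
    rw [h, zero_re] at this
    linarith [two_le_log_div_two_pi ht]
  have := (hd.analyticOnNhd hopen s ⟨hs, ht0⟩).analyticOrderAt_sub_eq_one_of_deriv_ne_zero hderiv
  rw [hsa] at this
  rw [analyticOrderNatAt, this]
  rfl

/-- The number of `a`-points, with or without multiplicity, differs by a constant from the number
of those above a certain height. -/
theorem exists_aPoints_count {a : ℂ} (ha : a ≠ 0) {t₀ : ℝ} {B : EReal} (ht₀ : 0 ≤ t₀)
    (hB : ((1 / 2 : ℝ) : EReal) < B) (h : 0 < t₀ ∨ B < ⊤ ∨ a.im = 0) :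
    ∃ (T₀ C : ℝ) (c d : ℕ), ∀ T, T₀ ≤ T → ∃ n : ℕ,
      |(n : ℝ) - mainTerm T / (2 * Real.pi)| ≤ C + 2 * Real.log T ∧
        aPointCount a t₀ B T = c + n ∧ (aPoints a t₀ B T).ncard = d + n := by
  obtain ⟨T₁, hT₁, hcount⟩ := exists_height_ncard_aPoints ha hB
  obtain ⟨T₂, hT₂, hclose⟩ := exists_height_abs_re_sub_half_lt a (ε := 1 / 4) (by norm_num)
  set T₀ := max (max T₁ T₂) t₀ with hT₀
  have hT₀1 : T₁ ≤ T₀ := (le_max_left _ _).trans (le_max_left _ _)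
  have hT₀2 : T₂ ≤ T₀ := (le_max_right _ _).trans (le_max_left _ _)
  have hT₀3 : t₀ ≤ T₀ := le_max_right _ _
  obtain ⟨C, hC⟩ := hcount T₀ hT₀1
  -- The set does not depend on T. The height T₀ + 1 is there because `aPoints` has a strict upper
  -- bound, and points of height exactly T₀ must be kept.
  set low : Set ℂ := aPoints a t₀ B (T₀ + 1) ∩ {s | s.im ≤ T₀} with hlow
  have hlowfin : low.Finite := (finite_aPoints ha ht₀ h (T₀ + 1)).inter_of_left _
  refine ⟨T₀ + 2, C, ∑ᶠ s ∈ low, analyticOrderNatAt (fun z : ℂ => feDelta z - a) s, low.ncard,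
    fun T hT => ?_⟩
  obtain ⟨hfin, hbound⟩ := hC T hT
  refine ⟨(aPoints a T₀ B T).ncard, hbound, ?_⟩
  have hunion : aPoints a t₀ B T = low ∪ aPoints a T₀ B T := by
    ext s
    constructor
    · rintro ⟨h1, h2, h3, h4, h5⟩
      rcases le_or_gt s.im T₀ with h6 | h6
      · exact Or.inl ⟨⟨h1, h2, h3, h4, by linarith⟩, h6⟩
      · exact Or.inr ⟨h1, h2, h3, h6, h5⟩
    · rintro (⟨⟨h1, h2, h3, h4, -⟩, h6⟩ | ⟨h1, h2, h3, h4, h5⟩)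
      · have h6' : s.im ≤ T₀ := h6
        exact ⟨h1, h2, h3, h4, by linarith⟩
      · exact ⟨h1, h2, h3, by linarith, h5⟩
  have hdisj : Disjoint low (aPoints a T₀ B T) := by
    rw [Set.disjoint_left]
    rintro s ⟨-, h6⟩ ⟨-, -, -, h4, -⟩
    exact absurd h4 (not_lt.2 h6)
  constructor
  · rw [aPointCount, hunion, finsum_mem_union hdisj hlowfin hfin]
    congr 1
    have : ∀ s ∈ aPoints a T₀ B T, analyticOrderNatAt (fun z : ℂ => feDelta z - a) s = 1 := by
      rintro s ⟨h1, -, -, h4, -⟩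
      have := abs_lt.1 (hclose s (by linarith) h1)
      exact analyticOrderNatAt_feDelta_sub (by linarith) (by linarith) h1
    rw [finsum_mem_congr rfl this, finsum_one]
  · rw [hunion, Set.ncard_union_eq hdisj hlowfin hfin]

theorem isBigO_log_of_count {N : ℝ → ℝ} {T₀ C : ℝ} {c : ℕ}
    (h : ∀ T, T₀ ≤ T → ∃ n : ℕ,
      |(n : ℝ) - mainTerm T / (2 * Real.pi)| ≤ C + 2 * Real.log T ∧ N T = c + n) :
    (fun T : ℝ => N T - T / (2 * Real.pi) * Real.log (T / (2 * Real.pi * Real.exp 1)))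
      =O[atTop] (fun T : ℝ => Real.log T) := by
  refine IsBigO.of_bound (c + |C| + 2) ?_
  filter_upwards [eventually_ge_atTop T₀, eventually_ge_atTop (Real.exp 1)] with T hT hT'
  obtain ⟨n, hn, hN⟩ := h T hT
  have hlog : 1 ≤ Real.log T :=
    (Real.le_log_iff_exp_le ((Real.exp_pos 1).trans_le hT')).2 hT'
  rw [Real.norm_eq_abs, Real.norm_of_nonneg (by linarith), hN]
  have e : (c : ℝ) + n - T / (2 * Real.pi) * Real.log (T / (2 * Real.pi * Real.exp 1)) =
      c + (n - mainTerm T / (2 * Real.pi)) := by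
    rw [mainTerm]; ring
  rw [e]
  refine (abs_add_le _ _).trans ?_
  rw [Nat.abs_cast]
  have h1 : (0 : ℝ) ≤ c + |C| := by positivity
  nlinarith [le_abs_self C, mul_le_mul_of_nonneg_left hlog h1]

/-! ### Limit of the real parts, and Julia lines. -/

theorem tendsto_re_aPoints (a : ℂ) :
    Tendsto Complex.re (comap Complex.im atTop ⊓ 𝓟 {s : ℂ | feDelta s = a}) (𝓝 (1 / 2)) := by
  rw [Metric.tendsto_nhds]
  intro ε hε
  obtain ⟨T, -, hT⟩ := exists_height_abs_re_sub_half_lt a hε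
  rw [eventually_inf_principal, eventually_comap]
  filter_upwards [eventually_ge_atTop T] with t ht s hst hs
  exact hT s (by rw [hst]; exact ht) hs

/-- The argument on the critical line falls by at least 2π over any sufficiently high interval of
length 2π, so it meets arg a modulo 2π there. -/
theorem exists_feDelta_eq_near_critical_line {a : ℂ} (ha : a ≠ 0) {ε : ℝ} (hε : 0 < ε) (T : ℝ) :
    ∃ s : ℂ, feDelta s = a ∧ |s.re - 1 / 2| < ε ∧ T < s.im := by
  obtain ⟨T₁, hT₁, hsolve⟩ := exists_height_exists_feDelta_eq ha (ρ := min (1 / 4) (ε / 2))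
    (lt_min (by norm_num) (by linarith)) (min_le_left _ _)
  set t₁ := max T₁ (T + 1) with ht₁
  have h1 : T₁ ≤ t₁ := le_max_left _ _
  have h2 : T + 1 ≤ t₁ := le_max_right _ _
  have h2pi := Real.two_pi_pos
  set m := ⌈(a.arg - criticalArg t₁) / (2 * Real.pi)⌉ with hm
  have hm1 := Int.le_ceil ((a.arg - criticalArg t₁) / (2 * Real.pi))
  have hm2 := Int.ceil_lt_add_one ((a.arg - criticalArg t₁) / (2 * Real.pi))
  rw [← hm, div_le_iff₀ h2pi] at hm1
  rw [← hm, ← sub_lt_iff_lt_add, lt_div_iff₀ h2pi] at hm2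
  have hdrop := criticalArg_sub_le (t := t₁) (u := t₁ + 2 * Real.pi) (by linarith) (by linarith)
  obtain ⟨t, ht, htm⟩ := intermediate_value_Icc' (show t₁ ≤ t₁ + 2 * Real.pi by linarith)
    (continuousOn_criticalArg.mono fun u hu => by simp only [Set.mem_Ici]; linarith [hu.1])
    (show a.arg - m * (2 * Real.pi) ∈ _ from ⟨by linarith, by linarith⟩)
  obtain ⟨s, hs, hsa, -⟩ := hsolve t (h1.trans ht.1) m htm
  have hre := (abs_re_le_norm _).trans (hs.trans (min_le_right _ _))
  have him := abs_le.1 ((abs_im_le_norm _).trans (hs.trans (min_le_left _ _)))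
  rw [sub_re, half_add_mul_I_re] at hre
  rw [sub_im, half_add_mul_I_im] at him
  exact ⟨s, hsa, by linarith, by linarith [ht.1]⟩

theorem isVerticalJuliaLine_feDelta_iff (σ : ℝ) : IsVerticalJuliaLine feDelta σ ↔ σ = 1 / 2 := by
  constructor
  · intro hJ
    by_contra hne
    have hpos : 0 < |σ - 1 / 2| / 2 := by
      have := abs_pos.2 (sub_ne_zero.2 hne)
      linarith
    -- Two distinct nonzero values missed near the line already exceed the one permitted exception.
    obtain ⟨T₁, h1, hT₁⟩ := exists_height_abs_re_sub_half_lt 1 hpos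
    obtain ⟨T₂, -, hT₂⟩ := exists_height_abs_re_sub_half_lt (-1) hpos
    have hmiss : ∀ z : ℂ, |z.re - σ| < |σ - 1 / 2| / 2 → ¬ |z.re - 1 / 2| < |σ - 1 / 2| / 2 := by
      intro z hz hz'
      have := abs_sub_le σ z.re (1 / 2)
      rw [abs_sub_comm σ z.re] at this
      linarith
    have h := hJ _ hpos (max T₁ T₂) (lt_max_of_lt_left (by linarith))
      (x := 1) (by
        rintro ⟨z, hz, hre, him⟩
        exact hmiss z hre (hT₁ z ((le_max_left _ _).trans him.le) hz))
      (y := -1) (by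
        rintro ⟨z, hz, hre, him⟩
        exact hmiss z hre (hT₂ z ((le_max_right _ _).trans him.le) hz))
    norm_num at h
  · rintro rfl ε hε T -
    have key : ∀ a : ℂ, (¬ ∃ z : ℂ, feDelta z = a ∧ |z.re - 1 / 2| < ε ∧ T < z.im) → a = 0 :=
      fun a h => by_contra fun ha => h (exists_feDelta_eq_near_critical_line ha hε T)
    exact fun x hx y hy => (key x hx).trans (key y hy).symm

theorem theorem1 (a : ℂ) (ha : a ≠ 0) :
    -- the counting formula, with and without multiplicity
    (∀ (t₀ : ℝ) (B : EReal), 0 ≤ t₀ → ((1 / 2 : ℝ) : EReal) < B →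
      (0 < t₀ ∨ B < ⊤ ∨ a.im = 0) →
        (∀ T : ℝ, (aPoints a t₀ B T).Finite) ∧
        (fun T : ℝ => (aPointCount a t₀ B T : ℝ)
            - T / (2 * Real.pi) * Real.log (T / (2 * Real.pi * Real.exp 1)))
          =O[atTop] (fun T : ℝ => Real.log T) ∧
        (fun T : ℝ => ((aPoints a t₀ B T).ncard : ℝ)
            - T / (2 * Real.pi) * Real.log (T / (2 * Real.pi * Real.exp 1)))
          =O[atTop] (fun T : ℝ => Real.log T)) ∧
    -- the real parts of the `a`-points tend to `1/2` as the imaginary parts tend to infinity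
    Tendsto Complex.re (comap Complex.im atTop ⊓ 𝓟 {s : ℂ | feDelta s = a}) (𝓝 (1 / 2)) ∧
    -- the critical line is the only vertical Julia line
    (∀ σ : ℝ, IsVerticalJuliaLine feDelta σ ↔ σ = 1 / 2) := by
  refine ⟨fun t₀ B ht₀ hB h => ?_, tendsto_re_aPoints a, isVerticalJuliaLine_feDelta_iff⟩
  obtain ⟨T₀, C, c, d, hcount⟩ := exists_aPoints_count ha ht₀ hB h
  refine ⟨finite_aPoints ha ht₀ h, isBigO_log_of_count (T₀ := T₀) (C := C) (c := c) fun T hT => ?_,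
    isBigO_log_of_count (T₀ := T₀) (C := C) (c := d) fun T hT => ?_⟩
  · obtain ⟨n, hn, h1, -⟩ := hcount T hT
    exact ⟨n, hn, by rw [h1]; push_cast; rfl⟩
  · obtain ⟨n, hn, -, h2⟩ := hcount T hT
    exact ⟨n, hn, by rw [h2]; push_cast; rfl⟩
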